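/- Proposition 4.5 (prop:MpIsNat). Let $(E,\omega,J)$ be a (finite-dimensional) Kähler vector space of complex dimension $N$, with inner product $g(u,v)=\omega(u,Jv)$ and norm $\|v\|^2=g(v,v)$. Let $\mathcal B(E)$ be its Bargmann space, consisting of the functions $\psi(v)=f(v)e^{-\|v\|^2/2}$ with $f:E\to\mathbb C$ holomorphic with respect to $J$ and $\psi\in L^2(E)$, and let $\mathcal B^\infty(E)\subset\mathcal B(E)$ be the space of smooth vectors, i.e. of those $\psi\in\mathcal B(E)$ such that $a\mapsto\langle\rho(a)\psi,\chi\rangle$ is smooth on $E$ for every $\chi\in\mathcal B(E)$, where $(\rho(a)\psi)(v)=e^{i\omega(a,v)}\psi(v-a)$. For a linear symplectic isomorphism $\Phi$ of $E$ let $$\mathcal W(\Phi)=\eta_{J,\Phi}\,P_E\circ U_\Phi:\mathcal B(E)\to\mathcal B(E),\qquad \eta_{J,\Phi}=2^{-N}\big(\det[(I-iJ)+\Phi(I+iJ)]\big)^{1/2},$$ where $U_\Phi\psi=\psi\circ\Phi^{-1}$, $P_E$ is the orthogonal projector of $L^2(E)$ onto $\mathcal B(E)$, the determinant is taken over $\mathbb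 C$ on $E\otimes\mathbb C$, and the square root is the principal one. Let $\mathcal C\subset E$ be a coisotropic subspace, that is, $\mathcal C^\circ\subset\mathcal C$, where $^\circ$ denotes the symplectic annihilator, and let $\mathcal H=\mathcal C\cap J(\mathcal C)$ be its maximal complex subspace. The reduction $F=\mathcal C/\mathcal C^\circ$ is a Kähler vector space through the identification $\mathcal H\cong F$ given by the projection $v\mapsto[v]$. For $\psi\in\mathcal B^\infty(E)$ put $$(R\psi)([v])=\int_{\mathcal C^\circ}\psi(v+y)\,dy,\qquad v\in\mathcal C,$$ where $dy$ is the measure on $\mathcal C^\circ$ induced by $g$. Let $\Phi:E\to E$ be a linear symplectic isomorphism such that 1. $\Phi(\mathcal C)=\mathcal C$, and 2. $\Phi(v)=v$ for all $v\in\mathcal H^\circ$, and let $\phi:F\to F$, $\phi([v])=[\Phi(v)]$, be the reduced symplectic map. Then these integrals converge absolutely and $R$ maps $\mathcal B^\infty(E)$ into $\mathcal B^\infty(F)$, the operator $\mathcal W(\Phi)$ maps $\mathcal B^\infty(E)$ into itself, and $$R\circ\mathcal W(\Phi)=\mathcal W(\phi)\circ R\qquad\text{on }\mathcal B^\infty(E).$$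 -/

import Mathlib

open MeasureTheory
open scoped ComplexConjugate TensorProduct

noncomputable section


namespace BargmannReduction

/-- A Kähler vector space: a real vector space with a symplectic form `ω` and a complex
structure `J` such that `g(u,v) = ω(u, J v)` is a positive definite inner product.  The inner
product `g` is the one carried by the `InnerProductSpace` structure, so that `‖v‖² = g(v,v)`. -/
class KahlerSpace (E : Type*) [NormedAddCommGroup E] [InnerProductSpace ℝ E] where
  /-- the complex structure -/
  J : E →ₗ[ℝ] E
  /-- the symplectic form -/
  symp : LinearMap.BilinForm ℝ E
  J_J : ∀ v, J (J v) = -v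
  symp_self : ∀ v, symp v v = 0
  inner_eq : ∀ u v, inner ℝ u v = symp u (J v)

open KahlerSpace

section Basic

variable {E : Type*} [NormedAddCommGroup E] [InnerProductSpace ℝ E] [KahlerSpace E]

theorem symp_swap (u v : E) : symp u v = - symp v u := by
  have h := symp_self (u + v)
  simp only [map_add, LinearMap.add_apply, symp_self] at h
  linarith

theorem inner_J_left (u v : E) : inner ℝ (J u) v = symp u v := by
  rw [real_inner_comm, inner_eq, J_J, map_neg, symp_swap u v]

theorem inner_J_right (u v : E) : inner ℝ u (J v) = - symp u v := by
  rw [inner_eq, J_J, map_neg]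

theorem inner_J_J (u v : E) : inner ℝ (J u) (J v) = inner ℝ u v := by
  rw [inner_J_left, inner_eq]

theorem symp_J_J (u v : E) : symp (J u) (J v) = symp u v := by
  rw [← inner_eq, inner_J_left]

theorem norm_J (v : E) : ‖J v‖ = ‖v‖ := by
  rw [@norm_eq_sqrt_real_inner E, @norm_eq_sqrt_real_inner E, inner_J_J]

/-- The symplectic annihilator `S° = {v | ω(u,v) = 0 for all u ∈ S}`. -/
def sympAnn (S : Submodule ℝ E) : Submodule ℝ E := S.orthogonalBilin symp

theorem mem_sympAnn {S : Submodule ℝ E} {v : E} : v ∈ sympAnn S ↔ ∀ u ∈ S, symp u v = 0 :=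
  Iff.rfl

/-- `C` is coisotropic: `C° ⊆ C`. -/
class IsCoisotropic (C : Submodule ℝ E) : Prop where
  ann_le : sympAnn C ≤ C

/-- The maximal complex subspace `H = C ∩ J(C)`. -/
def maxComplex (C : Submodule ℝ E) : Submodule ℝ E := C ⊓ C.map J

/-- The group `Sp(E)` of linear symplectic isomorphisms. -/
def Sp (E : Type*) [NormedAddCommGroup E] [InnerProductSpace ℝ E] [KahlerSpace E] :
    Subgroup (E ≃ₗ[ℝ] E) where
  carrier := {Φ | ∀ u v, symp (Φ u) (Φ v) = symp u v}
  mul_mem' := fun {a b} ha hb u v => (ha (b u) (b v)).trans (hb u v)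
  one_mem' := fun _ _ => rfl
  inv_mem' := fun {a} ha u v => by
    have h := ha (a.symm u) (a.symm v)
    simp only [LinearEquiv.apply_symm_apply] at h
    exact h.symm

end Basic

/-! ### Bargmann space -/

section Bargmann

variable {E : Type*} [NormedAddCommGroup E] [InnerProductSpace ℝ E] [KahlerSpace E]

/-- Solutions of `∂̄ f = 0` with respect to the complex structure `J`. -/
def IsHolomorphic (f : E → ℂ) : Prop :=
  Differentiable ℝ f ∧ ∀ v u, fderiv ℝ f v (J u) = Complex.I * fderiv ℝ f v u

/-- The Heisenberg operators `(ρ(a)ψ)(v) = exp(i ω(a,v)) ψ(v - a)`. -/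
def heis (a : E) (ψ : E → ℂ) : E → ℂ :=
  fun v => Complex.exp (Complex.I * (symp a v : ℝ)) * ψ (v - a)

variable [FiniteDimensional ℝ E] [MeasurableSpace E] [BorelSpace E]

variable (E) in
/-- The Bargmann space `B(E)`: the functions `ψ(v) = f(v) exp(-‖v‖²/2)` with `f` holomorphic and
`ψ` square integrable (with respect to the Lebesgue measure of the inner product `g`). -/
def bargmann : Submodule ℂ (E → ℂ) where
  carrier := {ψ | (∃ f : E → ℂ, IsHolomorphic f ∧
      ∀ v, ψ v = f v * (Real.exp (-‖v‖ ^ 2 / 2) : ℝ)) ∧ MemLp ψ 2 (volume : Measure E)}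
  zero_mem' := ⟨⟨fun _ => 0, ⟨differentiable_const 0, by simp⟩, by simp⟩, MemLp.zero⟩
  add_mem' := by
    rintro ψ₁ ψ₂ ⟨⟨f₁, h₁, e₁⟩, m₁⟩ ⟨⟨f₂, h₂, e₂⟩, m₂⟩
    refine ⟨⟨f₁ + f₂, ⟨h₁.1.add h₂.1, fun v u => ?_⟩, fun v => ?_⟩, m₁.add m₂⟩
    · rw [fderiv_add (h₁.1 v) (h₂.1 v)]
      simp only [add_apply, h₁.2, h₂.2, mul_add]
    · simp only [Pi.add_apply, e₁, e₂, add_mul]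
  smul_mem' := by
    rintro c ψ ⟨⟨f, h, e⟩, m⟩
    refine ⟨⟨c • f, ⟨h.1.const_smul c, fun v u => ?_⟩, fun v => ?_⟩, m.const_smul c⟩
    · rw [fderiv_const_smul (h.1 v)]
      simp only [smul_apply, h.2, smul_eq_mul]
      ring
    · simp only [Pi.smul_apply, e, smul_eq_mul, mul_assoc]

variable (E) in
/-- The smooth vectors `B^∞(E)` of the Heisenberg representation: those `ψ ∈ B(E)` for which
`a ↦ ⟨ρ(a)ψ, φ⟩` is smooth for all `φ ∈ B(E)`. -/
def smoothVectors : Set (E → ℂ) :=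
  {ψ | ψ ∈ bargmann E ∧ ∀ φ ∈ bargmann E,
    ContDiff ℝ ((⊤ : ℕ∞) : WithTop ℕ∞) fun a : E => ∫ v, heis a ψ v * conj (φ v)}

/-! The Bargmann space is closed in `L²`, so that the orthogonal projector onto it exists. -/

/-- `v ↦ cos θ v + sin θ J v` -/
def rot (θ : ℝ) : E ≃ₗᵢ[ℝ] E :=
  LinearIsometry.toLinearIsometryEquiv
    { toLinearMap := Real.cos θ • LinearMap.id + Real.sin θ • J
      norm_map' := fun v => by
        have h : ‖Real.cos θ • v + Real.sin θ • J v‖ ^ 2 = ‖v‖ ^ 2 := by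
          rw [@norm_add_sq_real E, norm_smul, norm_smul, norm_J, inner_smul_left, inner_smul_right,
            inner_J_right, symp_self]
          simp only [Real.norm_eq_abs, mul_pow, sq_abs]
          simp only [neg_zero, mul_zero, add_zero]
          rw [← add_mul, Real.cos_sq_add_sin_sq, one_mul]
        exact (pow_left_inj₀ (norm_nonneg _) (norm_nonneg _) two_ne_zero).1 h } rfl

theorem rot_apply (θ : ℝ) (v : E) : rot θ v = Real.cos θ • v + Real.sin θ • J v := rfl


theorem differentiable_slice {f : E → ℂ} (hf : IsHolomorphic f) (v : E) :
    Differentiable ℂ fun z : ℂ => f (z.re • v + z.im • J v) := by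
  intro z
  have hL : ∀ z : ℂ, HasFDerivAt (fun z : ℂ => f (z.re • v + z.im • J v))
      ((fderiv ℝ f (z.re • v + z.im • J v)).comp
        (Complex.reCLM.smulRight v + Complex.imCLM.smulRight (J v))) z := fun z =>
    ((hf.1 _).hasFDerivAt).comp z
      (f := fun z : ℂ => z.re • v + z.im • J v)
      ((Complex.reCLM.smulRight v + Complex.imCLM.smulRight (J v)).hasFDerivAt)
  refine differentiableAt_complex_iff_differentiableAt_real.2 ⟨(hL z).differentiableAt, ?_⟩
  rw [(hL z).fderiv]
  simp [hf.2]

theorem circle_mean {f : E → ℂ} (hf : IsHolomorphic f) (v : E) :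
    ∫ θ in (0 : ℝ)..2 * Real.pi, f (rot θ v) = (2 * Real.pi) * f 0 := by
  have h := ((differentiable_slice hf v).diffContOnCl (s := Metric.ball 0 |1|)).circleAverage
  rw [Real.circleAverage_def] at h
  simp only [Complex.zero_re, Complex.zero_im, zero_smul, add_zero] at h
  rw [← h]
  have e : ∀ θ : ℝ, f (rot θ v) = f ((circleMap 0 1 θ).re • v + (circleMap 0 1 θ).im • J v) := by
    intro θ
    simp [rot_apply, circleMap, Complex.exp_ofReal_mul_I_re, Complex.exp_ofReal_mul_I_im]
  simp only [e]
  have : (2 * Real.pi : ℝ) ≠ 0 := by positivity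
  rw [Complex.real_smul]
  push_cast
  rw [← mul_assoc, mul_inv_cancel₀ (by exact_mod_cast this), one_mul]

theorem integrable_gauss {b : ℝ} (hb : 0 < b) :
    Integrable (fun v : E => Real.exp (-b * ‖v‖ ^ 2)) := by
  have h := (GaussianFourier.integrable_cexp_neg_mul_sq_norm_add (V := E) (b := b)
    (by simpa using hb) 0 0).re
  refine h.congr (Filter.Eventually.of_forall fun v => ?_)
  simp only [zero_mul, add_zero]
  rw [show (-(b : ℂ) * (‖v‖ : ℂ) ^ 2) = ((-b * ‖v‖ ^ 2 : ℝ) : ℂ) by push_cast; ring]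
  exact Complex.exp_ofReal_re _

theorem memLp_gauss {b : ℝ} (hb : 0 < b) :
    MemLp (fun v : E => ((Real.exp (-b * ‖v‖ ^ 2) : ℝ) : ℂ)) 2 (volume : Measure E) := by
  have hc : Continuous fun v : E => ((Real.exp (-b * ‖v‖ ^ 2) : ℝ) : ℂ) := by fun_prop
  rw [memLp_two_iff_integrable_sq_norm hc.aestronglyMeasurable]
  refine (integrable_gauss (E := E) (b := 2 * b) (by positivity)).congr
    (Filter.Eventually.of_forall fun v => ?_)
  simp only [Complex.norm_real, Real.norm_eq_abs, sq_abs]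
  rw [← Real.exp_nat_mul]
  congr 1; push_cast; ring

theorem gauss_mean {f : E → ℂ} (hf : IsHolomorphic f)
    (hi : Integrable fun v : E => f v * (Real.exp (-‖v‖ ^ 2) : ℝ)) :
    ∫ v, f v * (Real.exp (-‖v‖ ^ 2) : ℝ) = (∫ v : E, (Real.exp (-‖v‖ ^ 2) : ℝ)) * f 0 := by
  have hfc : Continuous f := hf.1.continuous
  set G : E → ℂ := fun v => f v * (Real.exp (-‖v‖ ^ 2) : ℝ) with hG
  have hrot : ∀ θ v, G (rot θ v) = f (rot θ v) * (Real.exp (-‖v‖ ^ 2) : ℝ) := fun θ v => by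
    simp only [hG, LinearIsometryEquiv.norm_map]
  have hmp : ∀ θ : ℝ, MeasurePreserving (rot (E := E) θ) := fun θ =>
    LinearIsometryEquiv.measurePreserving _
  have hemb : ∀ θ : ℝ, MeasurableEmbedding (rot (E := E) θ) := fun θ =>
    (rot θ).toHomeomorph.measurableEmbedding
  have hconst : ∀ θ : ℝ, ∫ v, G (rot θ v) = ∫ v, G v := fun θ =>
    (hmp θ).integral_comp (hemb θ) G
  have hcont : Continuous fun p : ℝ × E => G (rot p.1 p.2) := by
    have hJ : Continuous (J : E →ₗ[ℝ] E) := LinearMap.continuous_of_finiteDimensional _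
    simp only [hG, rot_apply]
    fun_prop
  have hpi : (2 * Real.pi : ℂ) ≠ 0 := by exact_mod_cast (by positivity : (2 * Real.pi : ℝ) ≠ 0)
  have hint : Integrable (Function.uncurry fun (θ : ℝ) (v : E) => G (rot θ v))
      ((volume.restrict (Set.uIoc 0 (2 * Real.pi))).prod volume) := by
    refine (integrable_prod_iff (f := Function.uncurry fun (θ : ℝ) (v : E) => G (rot θ v))
      hcont.aestronglyMeasurable).2 ⟨Filter.Eventually.of_forall fun θ => ?_, ?_⟩
    · exact ((hmp θ).integrable_comp_emb (hemb θ)).2 hi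
    · have : ∀ θ : ℝ, ∫ v, ‖G (rot θ v)‖ = ∫ v, ‖G v‖ := fun θ =>
        (hmp θ).integral_comp (hemb θ) fun v => ‖G v‖
      simp only [Function.uncurry, this]
      have : IsFiniteMeasure ((volume : Measure ℝ).restrict (Set.uIoc 0 (2 * Real.pi))) := by
        rw [Set.uIoc]; infer_instance
      exact integrable_const _
  have h1 : ∫ θ in (0 : ℝ)..2 * Real.pi, ∫ v, G (rot θ v) = (2 * Real.pi) * ∫ v, G v := by
    simp only [hconst]
    rw [intervalIntegral.integral_const, Complex.real_smul]
    push_cast; ring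
  have h2 : ∫ θ in (0 : ℝ)..2 * Real.pi, ∫ v, G (rot θ v)
      = ∫ v, ∫ θ in (0 : ℝ)..2 * Real.pi, G (rot θ v) :=
    intervalIntegral_integral_swap hint
  have h3 : ∀ v, ∫ θ in (0 : ℝ)..2 * Real.pi, G (rot θ v)
      = (2 * Real.pi) * ((Real.exp (-‖v‖ ^ 2) : ℝ) * f 0) := fun v => by
    simp only [hrot]
    rw [intervalIntegral.integral_mul_const, circle_mean hf]
    ring
  rw [h2] at h1
  simp only [h3] at h1
  rw [integral_const_mul] at h1
  rw [← mul_left_cancel₀ hpi h1, integral_mul_const, integral_complex_ofReal]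

/-- The real-linear functional `w ↦ g(v,w) + i ω(v,w)`; it is holomorphic in `w`. -/
def kexp (v : E) : E →L[ℝ] ℂ :=
  LinearMap.toContinuousLinearMap
    (Complex.ofRealCLM.toLinearMap ∘ₗ (innerₗ E v)
      + Complex.I • (Complex.ofRealCLM.toLinearMap ∘ₗ (symp v)))

theorem kexp_apply (v w : E) :
    kexp v w = ((inner ℝ v w : ℝ) : ℂ) + Complex.I * ((symp v w : ℝ) : ℂ) := by
  simp [kexp]

theorem kexp_J (v w : E) : kexp v (J w) = Complex.I * kexp v w := by
  rw [kexp_apply, kexp_apply, inner_J_right, ← inner_eq, mul_add, ← mul_assoc, Complex.I_mul_I]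
  push_cast; ring

theorem kexp_re (v w : E) : (kexp v w).re = inner ℝ v w := by
  rw [kexp_apply]; simp

theorem norm_cexp_kexp (v w : E) : ‖Complex.exp (kexp v w)‖ = Real.exp (inner ℝ v w) := by
  rw [Complex.norm_exp, kexp_re]

theorem exp_inner_le (v w : E) :
    Real.exp (inner ℝ v w) ≤ Real.exp (‖w‖ ^ 2) * Real.exp (‖v‖ ^ 2 / 4) := by
  rw [← Real.exp_add]
  refine Real.exp_le_exp.2 ((real_inner_le_norm v w).trans ?_)
  nlinarith [sq_nonneg (‖w‖ - ‖v‖ / 2)]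

/-- The (unnormalized, conjugated) reproducing kernel. -/
def kern (w v : E) : ℂ := ((Real.exp (-‖v‖ ^ 2 / 2) : ℝ) : ℂ) * Complex.exp (kexp v w)

theorem continuous_kern (w : E) : Continuous (kern w) := by
  have h : Continuous fun v : E => symp v w :=
    LinearMap.continuous_of_finiteDimensional ((LinearMap.flip symp) w)
  unfold kern
  simp only [kexp_apply]
  fun_prop

theorem norm_kern_le (w v : E) :
    ‖kern w v‖ ≤ Real.exp (‖w‖ ^ 2) * Real.exp (-(1 / 4) * ‖v‖ ^ 2) := by
  rw [kern, norm_mul, norm_cexp_kexp, Complex.norm_real, Real.norm_eq_abs, Real.abs_exp]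
  refine (mul_le_mul_of_nonneg_left (exp_inner_le v w) (Real.exp_pos _).le).trans (le_of_eq ?_)
  rw [← Real.exp_add, ← Real.exp_add, ← Real.exp_add]
  congr 1; ring

theorem memLp_kern (w : E) : MemLp (kern w) 2 (volume : Measure E) := by
  refine ((memLp_gauss (E := E) (b := 1 / 4) (by norm_num)).const_mul
    ((Real.exp (‖w‖ ^ 2) : ℝ) : ℂ)).of_le (continuous_kern w).aestronglyMeasurable
    (Filter.Eventually.of_forall fun v => (norm_kern_le w v).trans (le_of_eq ?_))
  rw [norm_mul, Complex.norm_real, Complex.norm_real, Real.norm_eq_abs, Real.norm_eq_abs,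
    Real.abs_exp, Real.abs_exp]

/-- The integral transform with kernel `kern`. -/
def kernInt (u : E → ℂ) (w : E) : ℂ := ∫ v, u v * kern w v

theorem reproducing {f : E → ℂ} (hf : IsHolomorphic f)
    (hm : MemLp (fun v => f v * (Real.exp (-‖v‖ ^ 2 / 2) : ℝ)) 2 (volume : Measure E)) (w : E) :
    kernInt (fun v => f v * (Real.exp (-‖v‖ ^ 2 / 2) : ℝ)) w
      = (∫ v : E, (Real.exp (-‖v‖ ^ 2) : ℝ)) * f w := by
  set h : E → ℂ := fun v => f (v + w) * Complex.exp (-kexp w v) with hh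
  have hd : ∀ v, HasFDerivAt h (f (v + w) • (Complex.exp (-kexp w v) • (-kexp w)) +
      Complex.exp (-kexp w v) • fderiv ℝ f (v + w)) v := by
    intro v
    have h1 : HasFDerivAt (fun v => f (v + w)) (fderiv ℝ f (v + w)) v :=
      (hasFDerivAt_comp_add_right w).2 (hf.1 _).hasFDerivAt
    have h2 : HasFDerivAt (fun v => Complex.exp (-kexp w v))
        (Complex.exp (-kexp w v) • (-kexp w)) v := ((kexp w).hasFDerivAt.neg).cexp
    exact h1.mul h2
  have hol : IsHolomorphic h := by
    refine ⟨fun v => (hd v).differentiableAt, fun v u => ?_⟩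
    rw [(hd v).fderiv]
    simp only [add_apply, smul_apply, neg_apply, smul_eq_mul, kexp_J, hf.2]
    ring
  have key : ∀ v, h (v - w) * (Real.exp (-‖v - w‖ ^ 2) : ℝ)
      = f v * (Real.exp (-‖v‖ ^ 2 / 2) : ℝ) * kern w v := by
    intro v
    have e : -kexp w (v - w) + ((-‖v - w‖ ^ 2 : ℝ) : ℂ)
        = ((-‖v‖ ^ 2 / 2 : ℝ) : ℂ) + (((-‖v‖ ^ 2 / 2 : ℝ) : ℂ) + kexp v w) := by
      rw [map_sub, kexp_apply, kexp_apply, kexp_apply, symp_self, symp_swap w v,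
        real_inner_self_eq_norm_sq, real_inner_comm, @norm_sub_sq_real E]
      push_cast; ring
    simp only [hh, kern, sub_add_cancel, Complex.ofReal_exp]
    rw [mul_assoc, mul_assoc, ← Complex.exp_add, ← Complex.exp_add, ← Complex.exp_add, e]
  have hint : Integrable fun v => f v * (Real.exp (-‖v‖ ^ 2 / 2) : ℝ) * kern w v :=
    hm.integrable_mul (memLp_kern w)
  have hint' : Integrable fun v => h v * (Real.exp (-‖v‖ ^ 2) : ℝ) := by
    simp only [← key] at hint
    simpa only [add_sub_cancel_right] using hint.comp_add_right w
  have := gauss_mean hol hint'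
  rw [← integral_sub_right_eq_self _ w] at this
  simp only [key] at this
  rw [kernInt, this]
  simp [hh]

theorem continuous_kexp : Continuous (kexp (E := E)) :=
  LinearMap.continuous_of_finiteDimensional
    ({ toFun := kexp
       map_add' := fun a b => by
         ext w; simp only [kexp_apply, add_apply, inner_add_left, map_add, LinearMap.add_apply]
         push_cast; ring
       map_smul' := fun r a => by
         ext w
         simp only [kexp_apply, smul_apply, inner_smul_left, map_smul, LinearMap.smul_apply,
           RingHom.id_apply, Complex.real_smul, conj_trivial, smul_eq_mul]
         push_cast; ring } : E →ₗ[ℝ] E →L[ℝ] ℂ)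

theorem norm_kexp_le (v : E) : ‖kexp v‖ ≤ 2 * ‖v‖ := by
  refine ContinuousLinearMap.opNorm_le_bound _ (by positivity) fun w => ?_
  rw [kexp_apply]
  refine (norm_add_le _ _).trans ?_
  rw [norm_mul, Complex.norm_I, Complex.norm_real, Complex.norm_real, ← inner_J_left]
  have h1 := norm_inner_le_norm (𝕜 := ℝ) v w
  have h2 := norm_inner_le_norm (𝕜 := ℝ) (J v) w
  rw [norm_J] at h2
  linarith

theorem holomorphic_kernInt {u : E → ℂ} (hu : MemLp u 2 (volume : Measure E)) :
    IsHolomorphic (kernInt u) := by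
  have hb : ∀ w v : E, ∀ w' ∈ Metric.ball w 1, ‖(u v * kern w' v) • kexp v‖
      ≤ ‖u v * ((8 * Real.exp ((‖w‖ + 1) ^ 2) : ℝ) *
        ((Real.exp (-(1 / 8) * ‖v‖ ^ 2) : ℝ) : ℂ))‖ := by
    intro w v w' hw'
    have hn : ‖w'‖ ≤ ‖w‖ + 1 := by
      have := norm_sub_norm_le w' w
      rw [mem_ball_iff_norm] at hw'
      linarith
    have h1 : ‖kern w' v‖ ≤ Real.exp ((‖w‖ + 1) ^ 2) * Real.exp (-(1 / 4) * ‖v‖ ^ 2) := by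
      refine (norm_kern_le w' v).trans (mul_le_mul_of_nonneg_right
        (Real.exp_le_exp.2 ?_) (Real.exp_pos _).le)
      gcongr
    have h2 : ‖kexp v‖ ≤ 8 * Real.exp (1 / 8 * ‖v‖ ^ 2) := by
      have h3 := Real.add_one_le_exp (1 / 8 * ‖v‖ ^ 2)
      have h4 := norm_kexp_le v
      nlinarith [sq_nonneg (‖v‖ - 1)]
    rw [norm_smul, norm_mul, norm_mul, norm_mul, Complex.norm_real, Complex.norm_real,
      Real.norm_of_nonneg (by positivity), Real.norm_of_nonneg (by positivity), mul_assoc]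
    refine mul_le_mul_of_nonneg_left ?_ (norm_nonneg _)
    refine (mul_le_mul h1 h2 (norm_nonneg _) (by positivity)).trans (le_of_eq ?_)
    have e : Real.exp (-(1 / 8) * ‖v‖ ^ 2)
        = Real.exp (-(1 / 4) * ‖v‖ ^ 2) * Real.exp (1 / 8 * ‖v‖ ^ 2) := by
      rw [← Real.exp_add]; congr 1; ring
    rw [e]; ring
  have hbi : ∀ w : E, Integrable fun v => u v * ((8 * Real.exp ((‖w‖ + 1) ^ 2) : ℝ) *
        ((Real.exp (-(1 / 8) * ‖v‖ ^ 2) : ℝ) : ℂ)) := fun w =>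
    hu.integrable_mul ((memLp_gauss (E := E) (b := 1 / 8) (by norm_num)).const_mul
      ((8 * Real.exp ((‖w‖ + 1) ^ 2) : ℝ) : ℂ))
  have hmeas : ∀ w : E, AEStronglyMeasurable (fun v => (u v * kern w v) • kexp v) volume :=
    fun w => (hu.1.mul (continuous_kern w).aestronglyMeasurable).smul
      continuous_kexp.aestronglyMeasurable
  have hd : ∀ w, HasFDerivAt (kernInt u) (∫ v, (u v * kern w v) • kexp v) w := by
    intro w
    refine hasFDerivAt_integral_of_dominated_of_fderiv_le (s := Metric.ball w 1)
      (F := fun w v => u v * kern w v) (F' := fun w v => (u v * kern w v) • kexp v)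
      (Metric.ball_mem_nhds w one_pos) ?_ ?_ (hmeas w)
      (Filter.Eventually.of_forall fun v w' hw' => hb w v w' hw') (hbi w).norm ?_
    · exact Filter.Eventually.of_forall fun w =>
        hu.1.mul (continuous_kern w).aestronglyMeasurable
    · exact hu.integrable_mul (memLp_kern w)
    · refine Filter.Eventually.of_forall fun v w _ => ?_
      have h := (((kexp v).hasFDerivAt (x := w)).cexp.const_mul
        ((Real.exp (-‖v‖ ^ 2 / 2) : ℝ) : ℂ)).const_mul (u v)
      refine h.congr_fderiv ?_
      simp only [smul_smul, kern]
  have hint : ∀ w, Integrable fun v => (u v * kern w v) • kexp v := fun w =>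
    (hbi w).norm.mono' (hmeas w)
      (Filter.Eventually.of_forall fun v => hb w v w (Metric.mem_ball_self one_pos))
  refine ⟨fun w => (hd w).differentiableAt, fun w x => ?_⟩
  rw [(hd w).fderiv, ContinuousLinearMap.integral_apply (hint w),
    ContinuousLinearMap.integral_apply (hint w), ← integral_const_mul]
  refine integral_congr_ae (Filter.Eventually.of_forall fun v => ?_)
  simp only [smul_apply, kexp_J, smul_eq_mul]
  ring

variable (E) in
/-- The Bargmann space as a subspace of `L²(E)`. -/
def bargmannL2 : Submodule ℂ (Lp ℂ 2 (volume : Measure E)) where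
  carrier := {u | ∃ ψ ∈ bargmann E, u =ᵐ[volume] ψ}
  zero_mem' := ⟨0, zero_mem _, Lp.coeFn_zero _ _ _⟩
  add_mem' := by
    rintro u₁ u₂ ⟨ψ₁, h₁, e₁⟩ ⟨ψ₂, h₂, e₂⟩
    exact ⟨ψ₁ + ψ₂, add_mem h₁ h₂, (Lp.coeFn_add _ _).trans (e₁.add e₂)⟩
  smul_mem' := by
    rintro c u ⟨ψ, h, e⟩
    exact ⟨c • ψ, Submodule.smul_mem _ c h, (Lp.coeFn_smul _ _).trans (e.const_smul c)⟩

variable (E) in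
/-- `∫ exp(-‖v‖²) dv`, the normalization of the reproducing kernel. -/
def gaussMass : ℝ := ∫ v : E, Real.exp (-‖v‖ ^ 2)

theorem gaussMass_pos : 0 < gaussMass E := by
  refine (integral_pos_iff_support_of_nonneg (fun v => (Real.exp_pos _).le) ?_).2 ?_
  · simpa using integrable_gauss (E := E) (b := 1) one_pos
  · have : Function.support (fun v : E => Real.exp (-‖v‖ ^ 2)) = Set.univ := by
      ext v; simp [(Real.exp_pos _).ne']
    rw [this]
    exact isOpen_univ.measure_pos volume Set.univ_nonempty

/-- The function representing the orthogonal projection. -/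
def kernProj (u : E → ℂ) (w : E) : ℂ :=
  ((gaussMass E : ℂ)⁻¹ * kernInt u w) * (Real.exp (-‖w‖ ^ 2 / 2) : ℝ)

theorem kernProj_of_mem {ψ : E → ℂ} (hψ : ψ ∈ bargmann E) : kernProj ψ = ψ := by
  obtain ⟨⟨f, hf, e⟩, m⟩ := hψ
  obtain rfl : ψ = fun v => f v * (Real.exp (-‖v‖ ^ 2 / 2) : ℝ) := funext e
  funext w
  have h0 : (gaussMass E : ℂ) ≠ 0 := by exact_mod_cast gaussMass_pos.ne'
  rw [kernProj, reproducing hf m w]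
  change ((gaussMass E : ℂ)⁻¹ * ((gaussMass E : ℂ) * f w)) * _ = _
  rw [inv_mul_cancel_left₀ h0]

theorem kernProj_congr {u u' : E → ℂ} (h : u =ᵐ[volume] u') : kernProj u = kernProj u' := by
  funext w
  unfold kernProj kernInt
  rw [integral_congr_ae (g := fun v => u' v * kern w v)]
  filter_upwards [h] with v hv
  rw [hv]

theorem mem_bargmannL2_iff (u : Lp ℂ 2 (volume : Measure E)) :
    u ∈ bargmannL2 E ↔ u =ᵐ[volume] kernProj u := by
  constructor
  · rintro ⟨ψ, h, e⟩
    rw [kernProj_congr e, kernProj_of_mem h]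
    exact e
  · intro e
    refine ⟨kernProj u, ⟨⟨_, ?_, fun v => rfl⟩, (memLp_congr_ae e).1 (Lp.memLp u)⟩, e⟩
    have h := holomorphic_kernInt (Lp.memLp u)
    refine ⟨h.1.const_mul _, fun v x => ?_⟩
    rw [fderiv_const_mul (h.1 v)]
    simp only [smul_apply, h.2, smul_eq_mul]
    ring

theorem tendsto_kernProj {u : ℕ → Lp ℂ 2 (volume : Measure E)} {u₀ : Lp ℂ 2 (volume : Measure E)}
    (h : Filter.Tendsto u Filter.atTop (nhds u₀)) (w : E) :
    Filter.Tendsto (fun n => kernProj (u n) w) Filter.atTop (nhds (kernProj u₀ w)) := by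
  have hk : MemLp (fun v => conj (kern w v)) 2 (volume : Measure E) := (memLp_kern w).star
  have e : ∀ u : Lp ℂ 2 (volume : Measure E), kernInt u w = inner ℂ hk.toLp u := by
    intro u
    rw [L2.inner_def, kernInt]
    refine integral_congr_ae ?_
    filter_upwards [hk.coeFn_toLp] with v hv
    rw [hv, RCLike.inner_apply, Complex.conj_conj]
  unfold kernProj
  simp only [e]
  exact ((Filter.Tendsto.inner tendsto_const_nhds h).const_mul _).mul_const _

variable (E) in
theorem isClosed_bargmannL2 : IsClosed (bargmannL2 E : Set (Lp ℂ 2 (volume : Measure E))) := by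
  rw [← isSeqClosed_iff_isClosed]
  intro u u₀ hu h
  have hu' : ∀ᵐ v, ∀ n, u n v = kernProj (u n) v :=
    ae_all_iff.2 fun n => (mem_bargmannL2_iff (u n)).1 (hu n)
  obtain ⟨ns, hns, hae⟩ := (tendstoInMeasure_of_tendsto_Lp h).exists_seq_tendsto_ae
  refine (mem_bargmannL2_iff u₀).2 ?_
  filter_upwards [hu', hae] with v h1 h2
  refine tendsto_nhds_unique h2 ?_
  simp only [h1]
  exact (tendsto_kernProj h v).comp hns.tendsto_atTop

instance : (bargmannL2 E).HasOrthogonalProjection :=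
  haveI : CompleteSpace (bargmannL2 E) := (isClosed_bargmannL2 E).completeSpace_coe
  inferInstance

/-- The orthogonal projector `P_E : L²(E) → B(E)`.  An element of `B(E)` is a function and not a
class modulo null sets, so the value is the representative that lies in `B(E)`, which is unique. -/
def bargmannProj (u : Lp ℂ 2 (volume : Measure E)) : E → ℂ :=
  ((bargmannL2 E).orthogonalProjectionOnto u).2.choose

theorem bargmannProj_mem (u : Lp ℂ 2 (volume : Measure E)) : bargmannProj u ∈ bargmann E :=
  ((bargmannL2 E).orthogonalProjectionOnto u).2.choose_spec.1

theorem bargmannProj_ae (u : Lp ℂ 2 (volume : Measure E)) :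
    (bargmannL2 E).starProjection u =ᵐ[volume] bargmannProj u :=
  ((bargmannL2 E).orthogonalProjectionOnto u).2.choose_spec.2

/-! ### The metaplectic operators -/

theorem memLp_comp_symm (Φ : E ≃ₗ[ℝ] E) {ψ : E → ℂ} (hψ : MemLp ψ 2 (volume : Measure E)) :
    MemLp (fun v => ψ (Φ.symm v)) 2 (volume : Measure E) := by
  have hc : Continuous Φ.symm := LinearMap.continuous_of_finiteDimensional Φ.symm.toLinearMap
  refine MemLp.comp_of_map (g := ψ) (f := Φ.symm) ?_ hc.aemeasurable
  have h := Measure.map_linearMap_addHaar_eq_smul_addHaar (volume : Measure E)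
    (f := Φ.symm.toLinearMap) (LinearEquiv.isUnit_det' Φ.symm).ne_zero
  rw [show (Φ.symm : E → E) = Φ.symm.toLinearMap from rfl, h]
  exact hψ.smul_measure ENNReal.ofReal_ne_top

/-- `U_Φ ψ = ψ ∘ Φ⁻¹`, for `ψ ∈ B(E) ⊆ L²(E)`, as an element of `L²(E)`. -/
def transportL2 (Φ : Sp E) (ψ : bargmann E) : Lp ℂ 2 (volume : Measure E) :=
  (memLp_comp_symm (Φ : E ≃ₗ[ℝ] E) ψ.2.2).toLp (fun v => (ψ : E → ℂ) ((Φ : E ≃ₗ[ℝ] E).symm v))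

/-- `η_{J,Φ} = 2^{-N} (det[(I - iJ) + Φ(I + iJ)])^{1/2}`, where `N` is the complex dimension of
`(E, J)`, the determinant is that of an endomorphism of the complexification of `E`, and the
square root is the principal one. -/
def metaplecticFactor (Φ : Sp E) : ℂ :=
  let Jc : Module.End ℂ (ℂ ⊗[ℝ] E) := LinearMap.baseChange ℂ (J : E →ₗ[ℝ] E)
  let Φc : Module.End ℂ (ℂ ⊗[ℝ] E) :=
    LinearMap.baseChange ℂ ((Φ : E ≃ₗ[ℝ] E) : E →ₗ[ℝ] E)
  ((2 : ℂ) ^ (Module.finrank ℝ E / 2))⁻¹ *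
    (LinearMap.det ((1 - Complex.I • Jc) + Φc * (1 + Complex.I • Jc))) ^ (1 / 2 : ℂ)

/-- The metaplectic operator `W(Φ) = η_{J,Φ} P_E ∘ U_Φ : B(E) → B(E)`. -/
def metaplectic (Φ : Sp E) (ψ : bargmann E) : bargmann E :=
  metaplecticFactor Φ • ⟨bargmannProj (transportL2 Φ ψ), bargmannProj_mem _⟩

end Bargmann

/-! ### Linear reduction -/

section Reduction

variable {E : Type*} [NormedAddCommGroup E] [InnerProductSpace ℝ E] [FiniteDimensional ℝ E]
  [KahlerSpace E]

theorem sympAnn_eq (C : Submodule ℝ E) : sympAnn C = (C.map J)ᗮ := by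
  ext v
  rw [mem_sympAnn, Submodule.mem_orthogonal]
  simp [inner_J_left]

theorem mem_of_symp_eq_zero {C : Submodule ℝ E} {w : E} (h : ∀ y ∈ sympAnn C, symp y w = 0) :
    w ∈ C := by
  have h1 : J w ∈ (C.map J)ᗮᗮ := by
    rw [Submodule.mem_orthogonal]
    intro y hy
    rw [inner_J_right, h y (by rwa [sympAnn_eq]), neg_zero]
  rw [Submodule.orthogonal_orthogonal] at h1
  obtain ⟨c, hc, e⟩ := h1
  have : c = w := by
    have := congrArg J e
    rwa [J_J, J_J, neg_inj] at this
  exact this ▸ hc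

theorem J_mem_maxComplex {C : Submodule ℝ E} {h : E} (hh : h ∈ maxComplex C) :
    J h ∈ maxComplex C := by
  obtain ⟨h1, c, hc, rfl⟩ := hh
  refine ⟨?_, _, h1, rfl⟩
  rw [J_J]
  exact C.neg_mem hc

variable (C : Submodule ℝ E)

/-- The reduction `F = C / C°` of a coisotropic subspace `C`. -/
def Reduction : Type _ := C ⧸ (sympAnn C).submoduleOf C

instance : AddCommGroup (Reduction C) :=
  inferInstanceAs (AddCommGroup (C ⧸ (sympAnn C).submoduleOf C))

instance : Module ℝ (Reduction C) :=
  inferInstanceAs (Module ℝ (C ⧸ (sympAnn C).submoduleOf C))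

/-- The projection `π : C → F`. -/
def proj : C →ₗ[ℝ] Reduction C := ((sympAnn C).submoduleOf C).mkQ

theorem proj_surjective : Function.Surjective (proj C) := Submodule.mkQ_surjective _

theorem proj_eq_zero {v : C} : proj C v = 0 ↔ (v : E) ∈ sympAnn C :=
  (Submodule.Quotient.mk_eq_zero _).trans Iff.rfl

variable [IsCoisotropic C]

theorem bijective_proj_maxComplex :
    Function.Bijective
      (proj C ∘ₗ Submodule.inclusion (inf_le_left : maxComplex C ≤ C)) := by
  constructor
  · rw [← LinearMap.ker_eq_bot, LinearMap.ker_eq_bot']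
    rintro ⟨h, hh⟩ e
    have h1 : h ∈ sympAnn C := (proj_eq_zero C).1 e
    have h2 := h1 (J h) (J_mem_maxComplex hh).1
    rw [symp_swap, ← inner_eq, neg_eq_zero, inner_self_eq_zero] at h2
    exact Subtype.ext h2
  · intro x
    obtain ⟨v, rfl⟩ := proj_surjective C x
    set w : E := v - (sympAnn C).starProjection (v : E) with hw
    have hp : (sympAnn C).starProjection (v : E) ∈ sympAnn C :=
      Submodule.starProjection_apply_mem _ _
    have hwC : w ∈ C := C.sub_mem v.2 (IsCoisotropic.ann_le hp)
    have hwo : ∀ y ∈ sympAnn C, symp y (J w) = 0 := fun y hy => by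
      rw [← inner_eq]
      exact (Submodule.mem_orthogonal _ _).1
        (Submodule.sub_starProjection_mem_orthogonal (v : E)) y hy
    refine ⟨⟨w, hwC, -J w, C.neg_mem (mem_of_symp_eq_zero hwo), by simp [J_J]⟩, ?_⟩
    rw [← sub_eq_zero, LinearMap.comp_apply, ← map_sub, proj_eq_zero]
    simp [hw]

/-- The identification `H ≅ F` given by the restriction of `π` to the maximal complex subspace. -/
def horizontal : maxComplex C ≃ₗ[ℝ] Reduction C :=
  LinearEquiv.ofBijective _ (bijective_proj_maxComplex C)

theorem horizontal_apply (h : maxComplex C) : horizontal C h = proj C ⟨h, h.2.1⟩ := rfl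

instance : NormedAddCommGroup (Reduction C) :=
  NormedAddCommGroup.induced (Reduction C) (maxComplex C) (horizontal C).symm
    (horizontal C).symm.injective

/-- The inner product that `F` inherits from `H`. -/
instance : InnerProductSpace ℝ (Reduction C) :=
  InnerProductSpace.induced (horizontal C).symm

instance : FiniteDimensional ℝ (Reduction C) := (horizontal C).finiteDimensional

/-- The Kähler structure that `F` inherits from `H`. -/
instance : KahlerSpace (Reduction C) where
  J := (horizontal C).toLinearMap ∘ₗ
    (J : E →ₗ[ℝ] E).restrict (fun _ h => J_mem_maxComplex (C := C) h) ∘ₗ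
    (horizontal C).symm.toLinearMap
  symp := (symp : LinearMap.BilinForm ℝ E).compl₁₂
    ((maxComplex C).subtype ∘ₗ (horizontal C).symm.toLinearMap)
    ((maxComplex C).subtype ∘ₗ (horizontal C).symm.toLinearMap)
  J_J v := by
    apply (horizontal C).symm.injective
    apply Subtype.ext
    simp [J_J]
  symp_self v := symp_self _
  inner_eq u v := by
    have h : inner ℝ u v =
        inner ℝ ((horizontal C).symm u : E) ((horizontal C).symm v : E) := rfl
    rw [h, inner_eq]
    simp

/-- The symplectic form of `F` is the reduced one: `ω_F([u],[v]) = ω(u,v)` for `u, v ∈ C`. -/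
theorem symp_proj (u v : C) : symp (proj C u) (proj C v) = symp (u : E) (v : E) := by
  have key : ∀ u : C, ∃ y ∈ sympAnn C, (u : E) = (horizontal C).symm (proj C u) + y := fun u => by
    refine ⟨u - (horizontal C).symm (proj C u), ?_, by abel⟩
    have h : proj C (u - ⟨(horizontal C).symm (proj C u), ((horizontal C).symm (proj C u)).2.1⟩)
        = 0 := by
      rw [map_sub, ← horizontal_apply, LinearEquiv.apply_symm_apply, sub_self]
    exact (proj_eq_zero C).1 h
  obtain ⟨y, hy, ey⟩ := key u
  obtain ⟨z, hz, ez⟩ := key v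
  have e : symp (proj C u) (proj C v)
      = symp ((horizontal C).symm (proj C u) : E) ((horizontal C).symm (proj C v) : E) := rfl
  have h1 : symp ((horizontal C).symm (proj C u) : E) z = 0 :=
    hz _ ((horizontal C).symm (proj C u)).2.1
  have h2 : symp y (v : E) = 0 := by rw [symp_swap, hy _ v.2, neg_zero]
  rw [e]
  conv_rhs => rw [ey, map_add, LinearMap.add_apply, h2, ez, map_add, h1]
  simp

instance : MeasurableSpace (Reduction C) := borel _

instance : BorelSpace (Reduction C) := ⟨rfl⟩

variable {C}

theorem map_sympAnn (Φ : Sp E) (hC : C.map ((Φ : E ≃ₗ[ℝ] E) : E →ₗ[ℝ] E) = C) :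
    ((sympAnn C).submoduleOf C).map
      ((Φ : E ≃ₗ[ℝ] E).ofSubmodules C C hC : C →ₗ[ℝ] C) = (sympAnn C).submoduleOf C := by
  have hmem : ∀ u ∈ C, ∃ c ∈ C, (Φ : E ≃ₗ[ℝ] E) c = u := fun u hu => by
    rw [← hC] at hu
    exact hu
  have hmem' : ∀ c ∈ C, (Φ : E ≃ₗ[ℝ] E) c ∈ C := fun c hc =>
    hC.le (Submodule.mem_map_of_mem hc)
  ext v
  constructor
  · rintro ⟨y, hy, rfl⟩ u hu
    obtain ⟨c, hc, rfl⟩ := hmem u hu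
    exact (Φ.2 c y).trans (hy c hc)
  · intro hv
    obtain ⟨c, hc, e⟩ := hmem v v.2
    refine ⟨⟨c, hc⟩, fun u hu => ?_, Subtype.ext e⟩
    have h := hv _ (hmem' u hu)
    change symp _ (v : E) = 0 at h
    rw [← e, Φ.2 u c] at h
    exact h

/-- The reduced map `φ : F → F`, `φ([v]) = [Φ(v)]`, of a symplectic map `Φ` with `Φ(C) = C`. -/
def reducedMap (Φ : Sp E) (hC : C.map ((Φ : E ≃ₗ[ℝ] E) : E →ₗ[ℝ] E) = C) : Sp (Reduction C) :=
  ⟨Submodule.Quotient.equiv _ _ ((Φ : E ≃ₗ[ℝ] E).ofSubmodules C C hC) (map_sympAnn Φ hC), by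
    intro x y
    obtain ⟨u, rfl⟩ := proj_surjective C x
    obtain ⟨v, rfl⟩ := proj_surjective C y
    change symp (proj C ((Φ : E ≃ₗ[ℝ] E).ofSubmodules C C hC u))
      (proj C ((Φ : E ≃ₗ[ℝ] E).ofSubmodules C C hC v)) = _
    rw [symp_proj, symp_proj]
    exact Φ.2 u v⟩

theorem reducedMap_proj (Φ : Sp E) (hC : C.map ((Φ : E ≃ₗ[ℝ] E) : E →ₗ[ℝ] E) = C) (v : C) :
    (reducedMap Φ hC : Reduction C ≃ₗ[ℝ] Reduction C) (proj C v)
      = proj C ⟨(Φ : E ≃ₗ[ℝ] E) v, hC.le (Submodule.mem_map_of_mem v.2)⟩ := rfl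

variable [MeasurableSpace E] [BorelSpace E]

variable (C) in
/-- The reduction operator `R`: restriction to `C` followed by integration over (the translates
of) `C°` with respect to the Euclidean measure, `(Rψ)([v]) = ∫_{C°} ψ(v + y) dy`. -/
def reduce (ψ : E → ℂ) : Reduction C → ℂ :=
  Quotient.lift (s := ((sympAnn C).submoduleOf C).quotientRel)
    (fun v : C => ∫ y : sympAnn C, ψ ((v : E) + (y : E)) ∂volume) (by
      intro v w h
      have h' : (v : E) - w ∈ sympAnn C :=
        (Submodule.quotientRel_def ((sympAnn C).submoduleOf C)).1 h
      have := integral_add_right_eq_self (μ := (volume : Measure (sympAnn C)))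
        (fun y : sympAnn C => ψ ((w : E) + (y : E))) ⟨(v : E) - w, h'⟩
      refine Eq.trans (integral_congr_ae (Filter.Eventually.of_forall fun y => ?_)) this
      simp only [Submodule.coe_add]
      congr 1
      abel)

theorem reduce_proj (ψ : E → ℂ) (v : C) :
    reduce C ψ (proj C v) = ∫ y : sympAnn C, ψ ((v : E) + (y : E)) ∂volume := rfl

end Reduction
end BargmannReduction
end
open BargmannReduction

noncomputable section

namespace BargmannReduction

open KahlerSpace
open scoped ContDiff

/-!
A vector `ψ` of the Bargmann space is smooth if and only if it decays rapidly. Indeed `ρ(a)` is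
`e^{‖a‖²/2}` times the Toeplitz operator with symbol `e^{2iω(a,·)}`, so the diagonal matrix
coefficient of `ψ` is a Gaussian times the characteristic function of the measure `|ψ(v)|² dv`. If
it is smooth, all the moments of this measure are finite, and the Gaussian bound on the reproducing
kernel turns them into pointwise decay.

Since `Φ` is the identity on `H°`, it respects the orthogonal Kähler splitting `E = H ⊕ H°`, and it
acts as `φ` on `H ≅ F`. The reproducing kernel of `E` is the product of those of `F` and `H°`, and
the slices of `ψ ∘ Φ⁻¹` along `H°` already belong to the Bargmann space of `H°`, so the projector
acts in the variable of `F` only and commutes with the integration over `C° ⊆ H°` by Fubini's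
theorem. The determinants for `Φ` and `φ` differ by the factor `2 ^ dim H°`, whose square root
cancels against the normalisation, so that `η_Φ = η_φ`.
-/

/-! ### Moments of measures with smooth characteristic function -/

section Moments

theorem exists_norm_sub_le_sq_of_even {r : ℝ → ℝ} (heven : Function.Even r) (hr : ContDiff ℝ 2 r) :
    ∃ c, ∀ t ∈ Set.Icc (0 : ℝ) 1, ‖r t - r 0‖ ≤ c * t ^ 2 := by
  obtain ⟨c, hc⟩ := exists_taylor_mean_remainder_bound (n := 1) (f := r) (zero_le_one' ℝ)
    (by simpa only [Nat.cast_one, one_add_one_eq_two] using hr.contDiffOn)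
  have hderiv : derivWithin r (Set.Icc 0 1) 0 = 0 := by
    have hodd : deriv r 0 = -deriv r 0 := by
      simpa only [neg_zero, heven _] using deriv_comp_neg r 0
    rw [(hr.differentiable two_ne_zero 0).derivWithin (uniqueDiffOn_Icc_zero_one 0 (by simp)),
      self_eq_neg.1 hodd]
  refine ⟨c, fun t ht => ?_⟩
  simpa [taylorWithinEval_succ, taylor_within_zero_eval, iteratedDerivWithin_one, hderiv]
    using hc t ht

theorem one_sub_cos_mul (t x : ℝ) :
    1 - Real.cos (t * x) = t ^ 2 / 2 * (x * Real.sinc (t * x / 2)) ^ 2 := by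
  have hsinc : t * (x * Real.sinc (t * x / 2)) = 2 * Real.sin (t * x / 2) := by
    rcases eq_or_ne (t * x / 2) 0 with h | h
    · rw [h, Real.sin_zero, Real.sinc_zero]
      linarith
    · rw [Real.sinc_of_ne_zero h]
      obtain ⟨ht, hx⟩ : t ≠ 0 ∧ x ≠ 0 := mul_ne_zero_iff.1 (div_ne_zero_iff.1 h).1
      field_simp
  have hcos : Real.cos (t * x) = 1 - 2 * Real.sin (t * x / 2) ^ 2 := by
    rw [← Real.cos_two_mul_eq_one_sub, mul_div_cancel₀ _ two_ne_zero]
  linear_combination -hcos - (t * (x * Real.sinc (t * x / 2)) / 2 + Real.sin (t * x / 2)) * hsinc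

section Real

variable {μ : Measure ℝ} [IsFiniteMeasure μ]

theorem integrable_cos_mul (t : ℝ) : Integrable (fun x => Real.cos (t * x)) μ :=
  .of_bound (by fun_prop) 1 (.of_forall fun x => Real.abs_cos_le_one _)

theorem re_charFun (t : ℝ) : (charFun μ t).re = ∫ x, Real.cos (t * x) ∂μ := by
  rw [charFun_apply_real, ← RCLike.re_to_complex, ← integral_re]
  · simp [← Complex.ofReal_mul, Complex.exp_ofReal_mul_I_re]
  · exact .of_bound (by fun_prop) 1 (.of_forall fun x => by
      rw [← Complex.ofReal_mul, Complex.norm_exp_ofReal_mul_I])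

theorem integrable_mul_sinc_sq {t : ℝ} (ht : t ≠ 0) :
    Integrable (fun x => (x * Real.sinc (t * x / 2)) ^ 2) μ := by
  refine (((integrable_const 1).sub (integrable_cos_mul t)).const_mul (2 / t ^ 2)).congr
    (.of_forall fun x => ?_)
  simp only [Pi.sub_apply, one_sub_cos_mul]
  field_simp

theorem integral_mul_sinc_sq_le {c t : ℝ} (ht : 0 < t)
    (hc : ‖(charFun μ t).re - (charFun μ 0).re‖ ≤ c * t ^ 2) :
    ∫ x, (x * Real.sinc (t * x / 2)) ^ 2 ∂μ ≤ 2 * c := by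
  have hdiff : (charFun μ 0).re - (charFun μ t).re
      = t ^ 2 / 2 * ∫ x, (x * Real.sinc (t * x / 2)) ^ 2 ∂μ := by
    rw [re_charFun, re_charFun, ← integral_sub (integrable_cos_mul 0) (integrable_cos_mul t),
      ← integral_const_mul]
    simp only [zero_mul, Real.cos_zero, one_sub_cos_mul]
  have hle := (le_abs_self _).trans (abs_sub_comm _ _ |>.trans_le hc)
  rw [hdiff] at hle
  exact le_of_mul_le_mul_left (by linarith) (by positivity : 0 < t ^ 2 / 2)

theorem integrable_sq_of_contDiff_charFun (hφ : ContDiff ℝ 2 (charFun μ)) :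
    Integrable (fun x : ℝ => x ^ 2) μ := by
  obtain ⟨c, hc⟩ := exists_norm_sub_le_sq_of_even (r := fun t => (charFun μ t).re)
    (fun t => by simp only [charFun_neg, Complex.conj_re]) (Complex.reCLM.contDiff.comp hφ)
  have hpos (n : ℕ) : 0 < 1 / ((n : ℝ) + 1) := by positivity
  have hle (n : ℕ) : 1 / ((n : ℝ) + 1) ≤ 1 := by
    rw [div_le_one (by positivity)]
    exact le_add_of_nonneg_left n.cast_nonneg
  have hint (n : ℕ) := integrable_mul_sinc_sq (μ := μ) (hpos n).ne'
  refine integrable_of_tendsto (.of_forall fun x => ?_) (fun n => (hint n).aestronglyMeasurable)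
    (ne_top_of_le_ne_top (ENNReal.ofReal_ne_top (r := 2 * c)) (Filter.liminf_le_of_le
      (by isBoundedDefault) fun b hb => ?_))
  · have harg : Filter.Tendsto (fun n : ℕ => 1 / ((n : ℝ) + 1) * x / 2) Filter.atTop (nhds 0) := by
      simpa using (tendsto_one_div_add_atTop_nhds_zero_nat.mul_const x).div_const 2
    simpa using (((Real.continuous_sinc.tendsto 0).comp harg).const_mul x).pow 2
  · obtain ⟨n, hb⟩ := hb.exists
    refine hb.trans ?_
    rw [← ofReal_integral_norm_eq_lintegral_enorm (hint n)]
    simp only [norm_pow, Real.norm_eq_abs, sq_abs]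
    exact ENNReal.ofReal_le_ofReal
      (integral_mul_sinc_sq_le (hpos n) (hc _ ⟨(hpos n).le, hle n⟩))

theorem memLp_two_mul_of_contDiff_charFun (hφ : ContDiff ℝ ∞ (charFun μ)) (k : ℕ) :
    MemLp id (2 * k : ℕ) μ := by
  induction k with
  | zero => simpa using aestronglyMeasurable_id
  | succ k ih =>
    let ν := μ.withDensity fun x => ((‖x‖₊ ^ (2 * k) : NNReal) : ENNReal)
    have hweight : Measurable fun x : ℝ => ‖x‖₊ ^ (2 * k) := by fun_prop
    have : IsFiniteMeasure ν := by
      refine isFiniteMeasure_withDensity ?_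
      simpa [enorm] using ih.integrable_norm_pow'.hasFiniteIntegral.ne
    have hν : charFun ν = fun t => (-1) ^ k * iteratedDeriv (2 * k) (charFun μ) t := by
      funext t
      rw [iteratedDeriv_charFun ih, charFun_apply_real,
        integral_withDensity_eq_integral_smul hweight, pow_mul, Complex.I_sq, ← mul_assoc,
        ← mul_pow, neg_mul_neg, one_mul, one_pow, one_mul]
      simp [NNReal.smul_def, pow_mul, ← Complex.ofReal_pow]
    have hsmooth : ContDiff ℝ 2 (charFun ν) := by
      rw [hν, iteratedDeriv_eq_iterate]
      exact contDiff_const.mul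
        ((hφ.iterate_deriv _).of_le (WithTop.coe_le_coe.2 (le_top : (2 : ℕ∞) ≤ ⊤)))
    have hsq := integrable_sq_of_contDiff_charFun hsmooth
    rw [integrable_withDensity_iff_integrable_coe_smul hweight] at hsq
    have hne : ((2 * (k + 1) : ℕ) : ENNReal) ≠ 0 := by positivity
    rw [← integrable_norm_rpow_iff aestronglyMeasurable_id hne (ENNReal.natCast_ne_top _)]
    refine hsq.congr (.of_forall fun x => ?_)
    simp only [ENNReal.toReal_natCast, Real.rpow_natCast, mul_add_one, pow_add]
    simp

theorem memLp_id_of_contDiff_charFun_real (hφ : ContDiff ℝ ∞ (charFun μ)) (k : ℕ) :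
    MemLp id k μ :=
  (memLp_two_mul_of_contDiff_charFun hφ k).mono_exponent (by
    exact_mod_cast Nat.le_mul_of_pos_left k two_pos)

end Real

theorem memLp_id_of_contDiff_charFun {E : Type*} [NormedAddCommGroup E] [InnerProductSpace ℝ E]
    [FiniteDimensional ℝ E] [MeasurableSpace E] [BorelSpace E] {μ : Measure E} [IsFiniteMeasure μ]
    (hφ : ContDiff ℝ ∞ (charFun μ)) (k : ℕ) :
    MemLp id k μ := by
  have hinner (a : E) : MemLp (fun v => inner ℝ a v) k μ := by
    have hline : charFun (μ.map (innerSL ℝ a)) = fun t : ℝ => charFun μ (t • a) := by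
      funext t
      rw [charFun_map_eq_charFunDual_smul, charFun_eq_charFunDual_toDualMap, map_smul]
      rfl
    refine MemLp.comp_of_map (f := innerSL ℝ a) (memLp_id_of_contDiff_charFun_real ?_ k)
      (by fun_prop)
    rw [hline]
    exact hφ.comp (by fun_prop)
  have hsum : id = fun v : E => ∑ i, inner ℝ (stdOrthonormalBasis ℝ E i) v •
      stdOrthonormalBasis ℝ E i :=
    funext fun v => ((stdOrthonormalBasis ℝ E).sum_repr' v).symm
  rw [hsum]
  exact memLp_finsetSum _ fun i _ =>
    (ContinuousLinearMap.toSpanSingleton ℝ (stdOrthonormalBasis ℝ E i)).comp_memLp' (hinner _)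

end Moments

/-! ### The reproducing kernel and Toeplitz operators -/

section Holomorphic

variable {V : Type*} [NormedAddCommGroup V] [InnerProductSpace ℝ V] [KahlerSpace V]
variable {E : Type*} [NormedAddCommGroup E] [InnerProductSpace ℝ E] [KahlerSpace E]

theorem isHolomorphic_const (c : ℂ) : IsHolomorphic fun _ : E => c :=
  ⟨differentiable_const c, fun v u => by simp⟩

theorem isHolomorphic_cexp {A : E →L[ℝ] ℂ} (hA : ∀ u, A (J u) = Complex.I * A u) :
    IsHolomorphic fun v => Complex.exp (A v) := by
  refine ⟨by fun_prop, fun v u => ?_⟩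
  rw [A.hasFDerivAt.cexp.fderiv]
  simp only [smul_apply, smul_eq_mul, hA]
  ring

namespace IsHolomorphic

theorem mul {f g : E → ℂ} (hf : IsHolomorphic f) (hg : IsHolomorphic g) :
    IsHolomorphic fun v => f v * g v := by
  refine ⟨hf.1.mul hg.1, fun v u => ?_⟩
  rw [fderiv_fun_mul (hf.1 v) (hg.1 v)]
  simp only [add_apply, smul_apply, smul_eq_mul, hf.2, hg.2]
  ring

theorem comp_add {f : E → ℂ} (hf : IsHolomorphic f) {i : V →L[ℝ] E}
    (hi : ∀ x, i (J x) = J (i x)) (y : E) : IsHolomorphic fun x => f (i x + y) := by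
  have hderiv (x : V) : HasFDerivAt (fun x => f (i x + y)) ((fderiv ℝ f (i x + y)).comp i) x :=
    (hf.1 _).hasFDerivAt.comp x (i.hasFDerivAt.add_const y)
  refine ⟨fun x => (hderiv x).differentiableAt, fun x u => ?_⟩
  rw [(hderiv x).fderiv, ContinuousLinearMap.comp_apply, ContinuousLinearMap.comp_apply, hi, hf.2]

end IsHolomorphic

end Holomorphic

section Projector

variable {E : Type*} [NormedAddCommGroup E] [InnerProductSpace ℝ E] [KahlerSpace E]
variable [FiniteDimensional ℝ E] [MeasurableSpace E] [BorelSpace E]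

theorem conj_kexp (v w : E) : conj (kexp v w) = kexp w v := by
  rw [kexp_apply, kexp_apply, symp_swap w v, real_inner_comm]
  simp

theorem isHolomorphic_cexp_kexp (w : E) : IsHolomorphic fun v => Complex.exp (kexp w v) :=
  isHolomorphic_cexp (kexp_J w)

theorem cexp_neg_kexp_mul_gauss (w v : E) :
    Complex.exp (-kexp w (v - w)) * (Real.exp (-‖v - w‖ ^ 2) : ℝ)
      = (Real.exp (-‖v‖ ^ 2 / 2) : ℝ) * kern w v := by
  rw [kern, Complex.ofReal_exp, Complex.ofReal_exp, ← Complex.exp_add, ← Complex.exp_add,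
    ← Complex.exp_add, map_sub, kexp_apply, kexp_apply, kexp_apply, symp_self, symp_swap w v,
    real_inner_self_eq_norm_sq, real_inner_comm, norm_sub_sq_real]
  congr 1
  push_cast
  ring

theorem norm_kern_mul_exp (w v : E) :
    ‖kern w v‖ * Real.exp (-‖w‖ ^ 2 / 2) = Real.exp (-‖v - w‖ ^ 2 / 2) := by
  rw [kern, norm_mul, norm_cexp_kexp, Complex.norm_real, Real.norm_eq_abs, Real.abs_exp,
    ← Real.exp_add, ← Real.exp_add, norm_sub_sq_real]
  congr 1
  ring

theorem continuous_of_mem_bargmann {ψ : E → ℂ} (hψ : ψ ∈ bargmann E) : Continuous ψ := by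
  obtain ⟨⟨f, hf, hψf⟩, -⟩ := hψ
  have := hf.1.continuous
  rw [funext hψf]
  fun_prop

theorem kernInt_of_integrable {f : E → ℂ} (hf : IsHolomorphic f) (w : E)
    (hint : Integrable fun v => f v * (Real.exp (-‖v‖ ^ 2 / 2) : ℝ) * kern w v) :
    kernInt (fun v => f v * (Real.exp (-‖v‖ ^ 2 / 2) : ℝ)) w = gaussMass E * f w := by
  let h : E → ℂ := fun v => f (v + w) * Complex.exp (-kexp w v)
  have hh : IsHolomorphic h :=
    (hf.comp_add (i := .id ℝ E) (fun _ => rfl) w).mul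
      (isHolomorphic_cexp (A := -kexp w) fun u => by simp [kexp_J])
  have hshift (v : E) : h (v - w) * (Real.exp (-‖v - w‖ ^ 2) : ℝ)
      = f v * (Real.exp (-‖v‖ ^ 2 / 2) : ℝ) * kern w v := by
    simp only [h, sub_add_cancel, mul_assoc, cexp_neg_kexp_mul_gauss]
  have hint' : Integrable fun v => h v * (Real.exp (-‖v‖ ^ 2) : ℝ) := by
    have := (integrable_congr (.of_forall hshift)).2 hint
    simpa only [add_sub_cancel_right] using this.comp_add_right w
  calc kernInt (fun v => f v * (Real.exp (-‖v‖ ^ 2 / 2) : ℝ)) w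
      = ∫ v, h v * (Real.exp (-‖v‖ ^ 2) : ℝ) := by
        rw [← integral_sub_right_eq_self (fun v => h v * (Real.exp (-‖v‖ ^ 2) : ℝ)) w]
        simp only [hshift, kernInt]
    _ = gaussMass E * h 0 := gauss_mean hh hint'
    _ = gaussMass E * f w := by simp [h]

theorem conj_kern_mem_bargmann (w : E) : (fun v => conj (kern w v)) ∈ bargmann E := by
  refine ⟨⟨fun v => Complex.exp (kexp w v), isHolomorphic_cexp_kexp w, fun v => ?_⟩,
    (memLp_kern w).star⟩
  dsimp only
  rw [kern, map_mul, Complex.conj_ofReal, ← Complex.exp_conj, conj_kexp, mul_comm]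

theorem integral_bargmannProj_mul_conj (u : Lp ℂ 2 (volume : Measure E)) {φ : E → ℂ}
    (hφ : φ ∈ bargmann E) :
    ∫ v, bargmannProj u v * conj (φ v) = ∫ v, u v * conj (φ v) := by
  have hinner (x : Lp ℂ 2 (volume : Measure E)) :
      ∫ v, x v * conj (φ v) = inner ℂ (hφ.2.toLp φ) x := by
    rw [L2.inner_def]
    refine integral_congr_ae ?_
    filter_upwards [hφ.2.coeFn_toLp] with v hv
    rw [hv, RCLike.inner_apply]
  have hmem : hφ.2.toLp φ ∈ bargmannL2 E := ⟨φ, hφ, hφ.2.coeFn_toLp⟩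
  calc ∫ v, bargmannProj u v * conj (φ v)
      = ∫ v, ((bargmannL2 E).starProjection u : Lp ℂ 2 (volume : Measure E)) v * conj (φ v) := by
        refine integral_congr_ae ?_
        filter_upwards [bargmannProj_ae u] with v hv
        rw [hv]
    _ = ∫ v, u v * conj (φ v) := by
        rw [hinner, hinner, ← Submodule.inner_starProjection_left_eq_right,
          Submodule.starProjection_eq_self_iff.2 hmem]

theorem bargmannProj_eq_kernProj (u : Lp ℂ 2 (volume : Measure E)) :
    bargmannProj u = kernProj u := by
  rw [← kernProj_of_mem (bargmannProj_mem u)]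
  funext w
  have h := integral_bargmannProj_mul_conj u (conj_kern_mem_bargmann w)
  simp only [Complex.conj_conj] at h
  rw [kernProj, kernProj, kernInt, kernInt, h]

theorem bargmannProj_toLp {u : E → ℂ} (hu : MemLp u 2 (volume : Measure E)) :
    bargmannProj (hu.toLp u) = kernProj u :=
  (bargmannProj_eq_kernProj _).trans (kernProj_congr hu.coeFn_toLp)

theorem integral_kernProj_mul_conj {u : E → ℂ} (hu : MemLp u 2 (volume : Measure E)) {φ : E → ℂ}
    (hφ : φ ∈ bargmann E) :
    ∫ v, kernProj u v * conj (φ v) = ∫ v, u v * conj (φ v) := by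
  rw [← bargmannProj_toLp hu, integral_bargmannProj_mul_conj _ hφ]
  refine integral_congr_ae ?_
  filter_upwards [hu.coeFn_toLp] with v hv
  rw [hv]

theorem kernProj_mem_bargmann {u : E → ℂ} (hu : MemLp u 2 (volume : Measure E)) :
    kernProj u ∈ bargmann E := by
  rw [← bargmannProj_toLp hu]
  exact bargmannProj_mem _

theorem metaplectic_apply (Φ : Sp E) (ψ : bargmann E) :
    (metaplectic Φ ψ : E → ℂ)
      = metaplecticFactor Φ • kernProj fun v => (ψ : E → ℂ) ((Φ : E ≃ₗ[ℝ] E).symm v) := by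
  rw [← bargmannProj_toLp (memLp_comp_symm (Φ : E ≃ₗ[ℝ] E) ψ.2.2)]
  rfl

end Projector

section Toeplitz

variable {E : Type*} [NormedAddCommGroup E] [InnerProductSpace ℝ E] [KahlerSpace E]

/-- Multiplication by the character `v ↦ e^{2iω(a,v)}`. The Heisenberg operator `ρ(a)` is, up to
the constant `e^{‖a‖²/2}`, the Toeplitz operator with this symbol. -/
def modulate (a : E) (ψ : E → ℂ) : E → ℂ :=
  fun v => Complex.exp ((2 * symp a v : ℝ) * Complex.I) * ψ v

theorem norm_modulate (a : E) (ψ : E → ℂ) (v : E) : ‖modulate a ψ v‖ = ‖ψ v‖ := by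
  rw [modulate, norm_mul, Complex.norm_exp_ofReal_mul_I, one_mul]

variable [FiniteDimensional ℝ E]

theorem continuous_modulate (a : E) {ψ : E → ℂ} (hψ : Continuous ψ) :
    Continuous (modulate a ψ) := by
  have : Continuous fun v : E => symp a v := LinearMap.continuous_of_finiteDimensional (symp a)
  unfold modulate
  fun_prop

variable [MeasurableSpace E] [BorelSpace E]

theorem cexp_kexp_mul_kern_sub (a w v : E) :
    Complex.exp (kexp a v) * kern (w - a) v
      = Complex.exp ((2 * symp a v : ℝ) * Complex.I) * kern w v := by
  have hexp : kexp a v + kexp v (w - a) = (2 * symp a v : ℝ) * Complex.I + kexp v w := by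
    rw [map_sub, kexp_apply a v, kexp_apply v a, symp_swap v a, real_inner_comm a v]
    push_cast
    ring
  rw [kern, kern, mul_left_comm, mul_left_comm (Complex.exp ((2 * symp a v : ℝ) * Complex.I)),
    ← Complex.exp_add, hexp, Complex.exp_add]

theorem cexp_symp_mul_gauss_sub (a w : E) :
    Complex.exp (Complex.I * (symp a w : ℝ)) * (Real.exp (-‖w - a‖ ^ 2 / 2) : ℝ)
      = (Real.exp (‖a‖ ^ 2 / 2) : ℝ) * Complex.exp (kexp a (w - a)) *
        (Real.exp (-‖w‖ ^ 2 / 2) : ℝ) := by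
  rw [Complex.ofReal_exp, Complex.ofReal_exp, Complex.ofReal_exp, ← Complex.exp_add,
    ← Complex.exp_add, ← Complex.exp_add, map_sub, kexp_apply, kexp_apply, symp_self,
    real_inner_self_eq_norm_sq, norm_sub_sq_real, real_inner_comm]
  congr 1
  push_cast
  ring

theorem memLp_modulate (a : E) {ψ : E → ℂ} (hψ : ψ ∈ bargmann E) :
    MemLp (modulate a ψ) 2 (volume : Measure E) :=
  hψ.2.of_le (continuous_modulate a (continuous_of_mem_bargmann hψ)).aestronglyMeasurable
    (.of_forall fun v => (norm_modulate a ψ v).le)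

theorem heis_eq_kernProj_modulate (a : E) {ψ : E → ℂ} (hψ : ψ ∈ bargmann E) (w : E) :
    heis a ψ w = (Real.exp (‖a‖ ^ 2 / 2) : ℝ) * kernProj (modulate a ψ) w := by
  obtain ⟨f, hf, hψf⟩ := hψ.1
  have hker (v : E) : modulate a ψ v * kern w v
      = f v * Complex.exp (kexp a v) * (Real.exp (-‖v‖ ^ 2 / 2) : ℝ) * kern (w - a) v := by
    rw [modulate, hψf]
    linear_combination -(f v * (Real.exp (-‖v‖ ^ 2 / 2) : ℝ)) * cexp_kexp_mul_kern_sub a w v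
  have hint : Integrable fun v => modulate a ψ v * kern w v :=
    (memLp_modulate a hψ).integrable_mul (memLp_kern w)
  have hkernInt : kernInt (modulate a ψ) w
      = gaussMass E * (f (w - a) * Complex.exp (kexp a (w - a))) := by
    simp only [hker] at hint
    rw [← kernInt_of_integrable (hf.mul (isHolomorphic_cexp_kexp a)) (w - a) hint]
    simp only [kernInt, hker]
  have hmass : (gaussMass E : ℂ) ≠ 0 := Complex.ofReal_ne_zero.2 gaussMass_pos.ne'
  rw [kernProj, hkernInt, inv_mul_cancel_left₀ hmass, heis, hψf]
  linear_combination f (w - a) * cexp_symp_mul_gauss_sub a w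

theorem integral_heis_mul_conj {ψ φ : E → ℂ} (hψ : ψ ∈ bargmann E) (hφ : φ ∈ bargmann E) (a : E) :
    ∫ v, heis a ψ v * conj (φ v)
      = (Real.exp (‖a‖ ^ 2 / 2) : ℝ) * ∫ v, modulate a ψ v * conj (φ v) := by
  simp only [heis_eq_kernProj_modulate a hψ, mul_assoc]
  rw [integral_const_mul, integral_kernProj_mul_conj (memLp_modulate a hψ) hφ]

end Toeplitz

/-! ### Smooth vectors and rapid decay -/

/-- Decay faster than any power of the norm, for `u` and not for its derivatives: on the Bargmann
space this characterises the smooth vectors, see `mem_smoothVectors_iff`. -/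
def RapidDecay {V G : Type*} [NormedAddCommGroup V] [NormedAddCommGroup G] (u : V → G) : Prop :=
  ∀ k : ℕ, ∃ c : ℝ, ∀ v, (1 + ‖v‖) ^ k * ‖u v‖ ≤ c

theorem exists_integrable_inv_one_add_norm_pow {V : Type*} [NormedAddCommGroup V]
    [NormedSpace ℝ V] [FiniteDimensional ℝ V] [MeasurableSpace V] [BorelSpace V] (μ : Measure V)
    [μ.IsAddHaarMeasure] : ∃ r : ℕ, Integrable (fun v => ((1 + ‖v‖) ^ r)⁻¹) μ := by
  refine ⟨Module.finrank ℝ V + 1, ?_⟩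
  refine (integrable_one_add_norm (μ := μ) (r := (Module.finrank ℝ V + 1 : ℕ))
    (by push_cast; linarith)).congr (.of_forall fun v => ?_)
  dsimp only
  rw [Real.rpow_neg (by positivity), Real.rpow_natCast]

namespace RapidDecay

variable {V G : Type*} [NormedAddCommGroup V] [NormedAddCommGroup G] {u : V → G}

theorem comp_antilipschitz {W : Type*} [NormedAddCommGroup W] (hu : RapidDecay u) {g : W → V}
    {K : NNReal} (hg : AntilipschitzWith K g) : RapidDecay fun w => u (g w) := by
  intro k
  obtain ⟨c, hc⟩ := hu k
  refine ⟨(1 + K * (1 + ‖g 0‖)) ^ k * c, fun w => ?_⟩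
  have hw : ‖w‖ ≤ K * ((1 + ‖g 0‖) * (1 + ‖g w‖)) := by
    have := hg.le_mul_dist w 0
    rw [dist_zero_right, dist_eq_norm] at this
    refine this.trans (mul_le_mul_of_nonneg_left ((norm_sub_le _ _).trans ?_) K.coe_nonneg)
    nlinarith [norm_nonneg (g w), norm_nonneg (g 0)]
  calc (1 + ‖w‖) ^ k * ‖u (g w)‖
      ≤ ((1 + K * (1 + ‖g 0‖)) * (1 + ‖g w‖)) ^ k * ‖u (g w)‖ := by
        gcongr
        linarith [norm_nonneg (g w)]
    _ = (1 + K * (1 + ‖g 0‖)) ^ k * ((1 + ‖g w‖) ^ k * ‖u (g w)‖) := by rw [mul_pow, mul_assoc]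
    _ ≤ (1 + K * (1 + ‖g 0‖)) ^ k * c := by gcongr; exact hc _

theorem comp_linearEquiv {W : Type*} [NormedAddCommGroup W] [NormedSpace ℝ V] [NormedSpace ℝ W]
    [FiniteDimensional ℝ W] (hu : RapidDecay u) (Φ : W ≃ₗ[ℝ] V) : RapidDecay fun w => u (Φ w) :=
  hu.comp_antilipschitz Φ.toContinuousLinearEquiv.antilipschitz

theorem const_smul {𝕜 : Type*} [NormedField 𝕜] [NormedSpace 𝕜 G] (hu : RapidDecay u) (a : 𝕜) :
    RapidDecay (a • u) := by
  intro k
  obtain ⟨c, hc⟩ := hu k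
  refine ⟨‖a‖ * c, fun v => ?_⟩
  rw [Pi.smul_apply, norm_smul, mul_left_comm]
  gcongr
  exact hc v

theorem norm_pow_smul [NormedSpace ℝ G] (hu : RapidDecay u) (n : ℕ) :
    RapidDecay fun v => ‖v‖ ^ n • u v := by
  intro k
  obtain ⟨c, hc⟩ := hu (k + n)
  refine ⟨c, fun v => le_trans ?_ (hc v)⟩
  rw [norm_smul, Real.norm_of_nonneg (by positivity), pow_add, mul_assoc]
  gcongr
  linarith

variable [NormedSpace ℝ V] [FiniteDimensional ℝ V] [MeasurableSpace V] [BorelSpace V]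
variable {μ : Measure V} [μ.IsAddHaarMeasure]

theorem integrable_one_add_norm_pow_mul (hu : RapidDecay u) (hm : AEStronglyMeasurable u μ)
    (k : ℕ) : Integrable (fun v => (1 + ‖v‖) ^ k * ‖u v‖) μ := by
  obtain ⟨r, hr⟩ := exists_integrable_inv_one_add_norm_pow μ
  obtain ⟨c, hc⟩ := hu (k + r)
  refine (hr.const_mul c).mono' ?_ (.of_forall fun v => ?_)
  · exact (by fun_prop : Continuous fun v : V => (1 + ‖v‖) ^ k).aestronglyMeasurable.mul hm.norm
  · rw [Real.norm_of_nonneg (by positivity), ← div_eq_mul_inv, le_div_iff₀ (by positivity),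
      mul_right_comm, ← pow_add]
    exact hc v

theorem integrable (hu : RapidDecay u) (hm : AEStronglyMeasurable u μ) : Integrable u μ := by
  rw [← integrable_norm_iff hm]
  simpa using hu.integrable_one_add_norm_pow_mul hm 0

theorem memLp_two (hu : RapidDecay u) (hm : AEStronglyMeasurable u μ) : MemLp u 2 μ := by
  rw [memLp_two_iff_integrable_sq_norm hm]
  obtain ⟨c, hc⟩ := hu 0
  refine ((hu.integrable hm).norm.const_mul c).mono' (hm.norm.pow 2) (.of_forall fun v => ?_)
  rw [Real.norm_of_nonneg (by positivity), sq]
  gcongr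
  simpa using hc v

end RapidDecay

theorem exists_one_add_pow_mul_exp_le (k : ℕ) :
    ∃ c : ℝ, ∀ r : ℝ, 0 ≤ r → (1 + r) ^ k * Real.exp (-r ^ 2 / 2) ≤ c := by
  refine ⟨k.factorial * Real.exp 2, fun r hr => ?_⟩
  have hpow : (1 + r) ^ k ≤ k.factorial * Real.exp (1 + r) := by
    have := Real.pow_div_factorial_le_exp (1 + r) (by positivity) k
    rwa [div_le_iff₀ (by positivity), mul_comm] at this
  calc (1 + r) ^ k * Real.exp (-r ^ 2 / 2)
      ≤ k.factorial * Real.exp (1 + r) * Real.exp (-r ^ 2 / 2) := by gcongr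
    _ = k.factorial * Real.exp (1 + r + -r ^ 2 / 2) := by rw [mul_assoc, ← Real.exp_add]
    _ ≤ k.factorial * Real.exp 2 := by
        gcongr
        nlinarith [sq_nonneg (r - 1)]

/-- The measure `|ψ(v)|² dv`, whose characteristic function is, up to a Gaussian factor, the
diagonal matrix coefficient `a ↦ ⟨ρ(a)ψ, ψ⟩`. -/
def normSqMeasure {V : Type*} [MeasureSpace V] (ψ : V → ℂ) : Measure V :=
  volume.withDensity fun v => (‖ψ v‖₊ ^ 2 : NNReal)

theorem isFiniteMeasure_normSqMeasure {V : Type*} [MeasureSpace V] {ψ : V → ℂ}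
    (hψ : MemLp ψ 2 volume) : IsFiniteMeasure (normSqMeasure ψ) := by
  refine isFiniteMeasure_withDensity ?_
  simpa [enorm] using ((memLp_two_iff_integrable_sq_norm hψ.1).1 hψ).hasFiniteIntegral.ne

theorem le_sq_mul_add_inv {x : ℝ} (hx : 0 < x) (y : ℝ) : y ≤ y ^ 2 * x + x⁻¹ := by
  have hsum : y ^ 2 * x + x⁻¹ = ((y * x) ^ 2 + 1) / x := by field_simp
  rw [hsum, le_div_iff₀ hx]
  nlinarith [sq_nonneg (y * x - 1)]

section SmoothVectors

variable {E : Type*} [NormedAddCommGroup E] [InnerProductSpace ℝ E] [KahlerSpace E]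
variable [FiniteDimensional ℝ E]

theorem contDiff_smul_J (c : ℝ) : ContDiff ℝ ∞ fun v : E => c • J v :=
  (LinearMap.toContinuousLinearMap (c • (J : E →ₗ[ℝ] E))).contDiff

variable [MeasurableSpace E] [BorelSpace E]

theorem norm_kernProj_le (u : E → ℂ) (w : E) :
    ‖kernProj u w‖ ≤ (gaussMass E)⁻¹ * ∫ v, ‖u v‖ * Real.exp (-‖v - w‖ ^ 2 / 2) := by
  have hnorm (v : E) : ‖u v * kern w v‖ * Real.exp (-‖w‖ ^ 2 / 2)
      = ‖u v‖ * Real.exp (-‖v - w‖ ^ 2 / 2) := by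
    rw [norm_mul, mul_assoc, norm_kern_mul_exp]
  rw [kernProj, norm_mul, norm_mul, norm_inv, Complex.norm_real, Complex.norm_real,
    Real.norm_of_nonneg gaussMass_pos.le, Real.norm_of_nonneg (Real.exp_pos _).le, mul_assoc]
  refine mul_le_mul_of_nonneg_left ?_ (inv_nonneg.2 gaussMass_pos.le)
  simp only [← hnorm, integral_mul_const]
  gcongr
  exact norm_integral_le_integral_norm _

theorem rapidDecay_kernProj {u : E → ℂ}
    (hu : ∀ k : ℕ, Integrable fun v => (1 + ‖v‖) ^ k * ‖u v‖) : RapidDecay (kernProj u) := by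
  intro k
  obtain ⟨c, hc⟩ := exists_one_add_pow_mul_exp_le k
  refine ⟨(gaussMass E)⁻¹ * ∫ v, c * ((1 + ‖v‖) ^ k * ‖u v‖), fun w => ?_⟩
  have htriangle (v : E) : 1 + ‖w‖ ≤ (1 + ‖v - w‖) * (1 + ‖v‖) := by
    have := norm_sub_le v (v - w)
    rw [sub_sub_cancel] at this
    nlinarith [norm_nonneg v, norm_nonneg (v - w)]
  have hpointwise (v : E) : (1 + ‖w‖) ^ k * (‖u v‖ * Real.exp (-‖v - w‖ ^ 2 / 2))
      ≤ c * ((1 + ‖v‖) ^ k * ‖u v‖) :=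
    calc (1 + ‖w‖) ^ k * (‖u v‖ * Real.exp (-‖v - w‖ ^ 2 / 2))
        ≤ ((1 + ‖v - w‖) * (1 + ‖v‖)) ^ k * (‖u v‖ * Real.exp (-‖v - w‖ ^ 2 / 2)) := by
          gcongr
          exact htriangle v
      _ = ((1 + ‖v - w‖) ^ k * Real.exp (-‖v - w‖ ^ 2 / 2)) * ((1 + ‖v‖) ^ k * ‖u v‖) := by
          rw [mul_pow]
          ring
      _ ≤ c * ((1 + ‖v‖) ^ k * ‖u v‖) := by
          gcongr
          exact hc _ (norm_nonneg _)
  calc (1 + ‖w‖) ^ k * ‖kernProj u w‖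
      ≤ (1 + ‖w‖) ^ k * ((gaussMass E)⁻¹ * ∫ v, ‖u v‖ * Real.exp (-‖v - w‖ ^ 2 / 2)) := by
        gcongr
        exact norm_kernProj_le u w
    _ = (gaussMass E)⁻¹ * ∫ v, (1 + ‖w‖) ^ k * (‖u v‖ * Real.exp (-‖v - w‖ ^ 2 / 2)) := by
        rw [mul_left_comm, integral_const_mul]
    _ ≤ (gaussMass E)⁻¹ * ∫ v, c * ((1 + ‖v‖) ^ k * ‖u v‖) := by
        refine mul_le_mul_of_nonneg_left ?_ (inv_nonneg.2 gaussMass_pos.le)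
        exact integral_mono_of_nonneg (.of_forall fun v => by positivity) ((hu k).const_mul c)
          (.of_forall hpointwise)

theorem mem_smoothVectors_of_rapidDecay {ψ : E → ℂ} (hψ : ψ ∈ bargmann E) (hr : RapidDecay ψ) :
    ψ ∈ smoothVectors E := by
  refine ⟨hψ, fun φ hφ => ?_⟩
  simp only [integral_heis_mul_conj hψ hφ]
  have hweight (n : ℕ) : Integrable fun v => ‖v‖ ^ n * ‖ψ v * conj (φ v)‖ := by
    have hψn : MemLp (fun v => ‖v‖ ^ n • ψ v) 2 (volume : Measure E) :=
      (hr.norm_pow_smul n).memLp_two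
        ((by fun_prop : Continuous fun v : E => ‖v‖ ^ n).aestronglyMeasurable.smul hψ.2.1)
    refine (hψn.integrable_mul hφ.2.star).norm.congr (.of_forall fun v => ?_)
    simp [mul_assoc]
  have hfourier := Real.contDiff_fourier (N := ⊤) fun n _ => hweight n
  have hmodulate (a : E) : ∫ v, modulate a ψ v * conj (φ v)
      = FourierTransform.fourier (fun v => ψ v * conj (φ v)) (-Real.pi⁻¹ • J a) := by
    rw [Real.fourier_eq']
    refine integral_congr_ae (.of_forall fun v => ?_)
    dsimp only [modulate]
    rw [inner_smul_right, inner_J_right, symp_swap v a, smul_eq_mul, mul_assoc]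
    congr 4
    field_simp
  simp only [hmodulate]
  refine ContDiff.mul ?_ (hfourier.comp (contDiff_smul_J _))
  exact Complex.ofRealCLM.contDiff.comp (Real.contDiff_exp.comp ((contDiff_norm_sq ℝ).div_const 2))

theorem charFun_normSqMeasure {ψ : E → ℂ} (hψ : ψ ∈ bargmann E) (s : E) :
    charFun (normSqMeasure ψ) s = (Real.exp (-‖(-2⁻¹ : ℝ) • J s‖ ^ 2 / 2) : ℝ) *
      ∫ v, heis ((-2⁻¹ : ℝ) • J s) ψ v * conj (ψ v) := by
  have hmeas : Measurable fun v => ‖ψ v‖₊ ^ 2 :=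
    ((continuous_of_mem_bargmann hψ).nnnorm.pow 2).measurable
  rw [integral_heis_mul_conj hψ hψ, ← mul_assoc, ← Complex.ofReal_mul, ← Real.exp_add, neg_div,
    neg_add_cancel, Real.exp_zero, Complex.ofReal_one, one_mul, charFun_apply, normSqMeasure,
    integral_withDensity_eq_integral_smul hmeas]
  refine integral_congr_ae (.of_forall fun v => ?_)
  have hphase : 2 * symp ((-2⁻¹ : ℝ) • J s) v = inner ℝ v s := by
    rw [map_smul, LinearMap.smul_apply, ← inner_J_left, J_J, inner_neg_left, real_inner_comm,
      smul_eq_mul]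
    ring
  dsimp only [modulate]
  rw [hphase, mul_assoc, Complex.mul_conj, Complex.normSq_eq_norm_sq, mul_comm]
  simp [NNReal.smul_def, mul_comm]

theorem contDiff_charFun_normSqMeasure {ψ : E → ℂ} (hψ : ψ ∈ smoothVectors E) :
    ContDiff ℝ ∞ (charFun (normSqMeasure ψ)) := by
  have hcoeff := hψ.2 ψ hψ.1
  have hexp : ContDiff ℝ ∞ fun a : E => ((Real.exp (-‖a‖ ^ 2 / 2) : ℝ) : ℂ) :=
    Complex.ofRealCLM.contDiff.comp
      (Real.contDiff_exp.comp ((contDiff_norm_sq ℝ).neg.div_const 2))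
  rw [funext (charFun_normSqMeasure hψ.1)]
  exact (hexp.comp (contDiff_smul_J _)).mul (hcoeff.comp (contDiff_smul_J _))

theorem integrable_one_add_norm_pow_mul_sq {ψ : E → ℂ} (hψ : ψ ∈ smoothVectors E) (n : ℕ) :
    Integrable fun v => (1 + ‖v‖) ^ n * ‖ψ v‖ ^ 2 := by
  have hfinite := isFiniteMeasure_normSqMeasure hψ.1.2
  have hmoment : MemLp (fun v => 1 + ‖v‖) n (normSqMeasure ψ) :=
    (memLp_const (1 : ℝ)).add
      (memLp_id_of_contDiff_charFun (contDiff_charFun_normSqMeasure hψ) n).norm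
  have hmeas : Measurable fun v => ‖ψ v‖₊ ^ 2 :=
    ((continuous_of_mem_bargmann hψ.1).nnnorm.pow 2).measurable
  have hint := hmoment.integrable_norm_pow'
  rw [normSqMeasure, integrable_withDensity_iff_integrable_coe_smul hmeas] at hint
  refine hint.congr (.of_forall fun v => ?_)
  simp only [NNReal.coe_pow, coe_nnnorm, smul_eq_mul]
  rw [Real.norm_of_nonneg (by positivity), mul_comm]

theorem integrable_one_add_norm_pow_mul {ψ : E → ℂ} (hψ : ψ ∈ smoothVectors E) (k : ℕ) :
    Integrable fun v => (1 + ‖v‖) ^ k * ‖ψ v‖ := by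
  have hcont := continuous_of_mem_bargmann hψ.1
  obtain ⟨r, hr⟩ := exists_integrable_inv_one_add_norm_pow (volume : Measure E)
  refine ((integrable_one_add_norm_pow_mul_sq hψ (2 * k + r)).add hr).mono'
    (by fun_prop : Continuous _).aestronglyMeasurable (.of_forall fun v => ?_)
  have hweight : 0 < (1 + ‖v‖) ^ r := by positivity
  rw [Real.norm_of_nonneg (by positivity), Pi.add_apply]
  exact (le_sq_mul_add_inv hweight _).trans_eq (by ring)

theorem mem_smoothVectors_iff {ψ : E → ℂ} :
    ψ ∈ smoothVectors E ↔ ψ ∈ bargmann E ∧ RapidDecay ψ := by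
  refine ⟨fun hψ => ⟨hψ.1, ?_⟩, fun hψ => mem_smoothVectors_of_rapidDecay hψ.1 hψ.2⟩
  rw [← kernProj_of_mem hψ.1]
  exact rapidDecay_kernProj (integrable_one_add_norm_pow_mul hψ)

theorem metaplectic_mem_smoothVectors (Φ : Sp E) {ψ : bargmann E}
    (hψ : (ψ : E → ℂ) ∈ smoothVectors E) : (metaplectic Φ ψ : E → ℂ) ∈ smoothVectors E := by
  refine mem_smoothVectors_iff.2 ⟨(metaplectic Φ ψ).2, ?_⟩
  rw [metaplectic_apply]
  exact (rapidDecay_kernProj (((mem_smoothVectors_iff.1 hψ).2.comp_linearEquiv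
    (Φ : E ≃ₗ[ℝ] E).symm).integrable_one_add_norm_pow_mul
      (memLp_comp_symm (Φ : E ≃ₗ[ℝ] E) ψ.2.2).1)).const_smul _

end SmoothVectors

/-! ### Orthogonal Kähler splittings -/

section Slice

variable {V E : Type*} [NormedAddCommGroup V] [InnerProductSpace ℝ V] [KahlerSpace V]
variable [FiniteDimensional ℝ V] [MeasurableSpace V] [BorelSpace V]
variable [NormedAddCommGroup E] [InnerProductSpace ℝ E] [KahlerSpace E]
variable [FiniteDimensional ℝ E] [MeasurableSpace E] [BorelSpace E]

theorem slice_mem_smoothVectors {ψ : E → ℂ} (hψ : ψ ∈ smoothVectors E) (i : V →ₗᵢ[ℝ] E)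
    (hi : ∀ x, i (J x) = J (i x)) {y : E} (hy : ∀ x, inner ℝ (i x) y = 0) :
    (fun x => ψ (i x + y)) ∈ smoothVectors V := by
  obtain ⟨hψB, hdecay⟩ := mem_smoothVectors_iff.1 hψ
  have hcont := continuous_of_mem_bargmann hψB
  have hslice : RapidDecay fun x => ψ (i x + y) :=
    hdecay.comp_antilipschitz ((isometry_add_right y).comp i.isometry).antilipschitz
  obtain ⟨⟨f, hf, hψf⟩, -⟩ := hψB
  refine mem_smoothVectors_iff.2 ⟨⟨⟨fun x => f (i x + y) * (Real.exp (-‖y‖ ^ 2 / 2) : ℝ),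
    (hf.comp_add (i := i.toContinuousLinearMap) hi y).mul (isHolomorphic_const _),
    fun x => ?_⟩, hslice.memLp_two (by fun_prop : Continuous _).aestronglyMeasurable⟩, hslice⟩
  dsimp only
  rw [hψf, norm_add_sq_real, hy, i.norm_map, mul_assoc, ← Complex.ofReal_mul, ← Real.exp_add]
  ring_nf

end Slice

theorem kernInt_of_mem {V : Type*} [NormedAddCommGroup V] [InnerProductSpace ℝ V] [KahlerSpace V]
    [FiniteDimensional ℝ V] [MeasurableSpace V] [BorelSpace V] {φ : V → ℂ} (hφ : φ ∈ bargmann V)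
    (v : V) : kernInt φ v = gaussMass V * (Real.exp (‖v‖ ^ 2 / 2) : ℝ) * φ v := by
  have hmass : (gaussMass V : ℂ) ≠ 0 := Complex.ofReal_ne_zero.2 gaussMass_pos.ne'
  have hexp : ((Real.exp (‖v‖ ^ 2 / 2) : ℝ) : ℂ) ≠ 0 :=
    Complex.ofReal_ne_zero.2 (Real.exp_pos _).ne'
  conv_rhs => rw [← kernProj_of_mem hφ]
  rw [kernProj, neg_div, Real.exp_neg, Complex.ofReal_inv]
  field_simp

/-- An identification of `E` with the orthogonal direct sum of the Kähler spaces `F` and `L`. -/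
structure KahlerSplitting (F L E : Type*)
    [NormedAddCommGroup F] [InnerProductSpace ℝ F] [KahlerSpace F]
    [NormedAddCommGroup L] [InnerProductSpace ℝ L] [KahlerSpace L]
    [NormedAddCommGroup E] [InnerProductSpace ℝ E] [KahlerSpace E] where
  equiv : (F × L) ≃ₗ[ℝ] E
  inner_map : ∀ p q, inner ℝ (equiv p) (equiv q) = inner ℝ p.1 q.1 + inner ℝ p.2 q.2
  J_map : ∀ p, J (equiv p) = equiv (J p.1, J p.2)

namespace KahlerSplitting

section Geometry

variable {F L E : Type*} [NormedAddCommGroup F] [InnerProductSpace ℝ F] [KahlerSpace F]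
variable [NormedAddCommGroup L] [InnerProductSpace ℝ L] [KahlerSpace L]
variable [NormedAddCommGroup E] [InnerProductSpace ℝ E] [KahlerSpace E]
variable (S : KahlerSplitting F L E)

theorem norm_sq_map (p : F × L) : ‖S.equiv p‖ ^ 2 = ‖p.1‖ ^ 2 + ‖p.2‖ ^ 2 := by
  simp only [← real_inner_self_eq_norm_sq, S.inner_map]

theorem symp_map (p q : F × L) :
    symp (S.equiv p) (S.equiv q) = symp p.1 q.1 + symp p.2 q.2 := by
  simp only [← inner_J_left, S.J_map, S.inner_map]

theorem norm_fst_le (p : F × L) : ‖p.1‖ ≤ ‖S.equiv p‖ :=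
  le_of_sq_le_sq (by linarith [S.norm_sq_map p, sq_nonneg ‖p.2‖]) (norm_nonneg _)

theorem norm_snd_le (p : F × L) : ‖p.2‖ ≤ ‖S.equiv p‖ :=
  le_of_sq_le_sq (by linarith [S.norm_sq_map p, sq_nonneg ‖p.1‖]) (norm_nonneg _)

/-- The inclusion of the first summand. -/
def inl : F →ₗᵢ[ℝ] E :=
  (S.equiv.toLinearMap ∘ₗ LinearMap.inl ℝ F L).isometryOfInner fun x x' => by simp [S.inner_map]

/-- The inclusion of the second summand. -/
def inr : L →ₗᵢ[ℝ] E :=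
  (S.equiv.toLinearMap ∘ₗ LinearMap.inr ℝ F L).isometryOfInner fun l l' => by simp [S.inner_map]

theorem inl_apply (x : F) : S.inl x = S.equiv (x, 0) := rfl

theorem inr_apply (l : L) : S.inr l = S.equiv (0, l) := rfl

theorem inl_add_inr (x : F) (l : L) : S.inl x + S.inr l = S.equiv (x, l) := by
  rw [inl_apply, inr_apply, ← map_add, Prod.mk_add_mk, add_zero, zero_add]

theorem inl_J (x : F) : S.inl (J x) = J (S.inl x) := by
  rw [inl_apply, inl_apply, S.J_map, map_zero]

theorem inr_J (l : L) : S.inr (J l) = J (S.inr l) := by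
  rw [inr_apply, inr_apply, S.J_map, map_zero]

theorem inner_inl_inr (x : F) (l : L) : inner ℝ (S.inl x) (S.inr l) = 0 := by
  rw [inl_apply, inr_apply, S.inner_map, inner_zero_right, inner_zero_left, add_zero]

variable [FiniteDimensional ℝ E] [MeasurableSpace E] [BorelSpace E] {ψ : E → ℂ}

theorem slice_fst_mem_bargmann [FiniteDimensional ℝ F] [MeasurableSpace F] [BorelSpace F]
    (hψ : ψ ∈ smoothVectors E) (l : L) :
    (fun x => ψ (S.equiv (x, l))) ∈ bargmann F := by
  simp only [← S.inl_add_inr]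
  exact (slice_mem_smoothVectors hψ S.inl S.inl_J fun x => S.inner_inl_inr x l).1

theorem slice_snd_mem_bargmann [FiniteDimensional ℝ L] [MeasurableSpace L] [BorelSpace L]
    (hψ : ψ ∈ smoothVectors E) (x : F) :
    (fun l => ψ (S.equiv (x, l))) ∈ bargmann L := by
  simp only [← S.inl_add_inr, add_comm (S.inl x)]
  exact (slice_mem_smoothVectors hψ S.inr S.inr_J fun l =>
    (real_inner_comm _ _).trans (S.inner_inl_inr x l)).1

end Geometry

variable {F L E : Type*} [NormedAddCommGroup F] [InnerProductSpace ℝ F] [KahlerSpace F]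
variable [FiniteDimensional ℝ F] [MeasurableSpace F] [BorelSpace F]
variable [NormedAddCommGroup L] [InnerProductSpace ℝ L] [KahlerSpace L]
variable [FiniteDimensional ℝ L] [MeasurableSpace L] [BorelSpace L]
variable [NormedAddCommGroup E] [InnerProductSpace ℝ E] [KahlerSpace E]
variable [MeasurableSpace E] [BorelSpace E] (S : KahlerSplitting F L E)

theorem measurableEmbedding : MeasurableEmbedding S.equiv :=
  S.equiv.toContinuousLinearEquiv.toHomeomorph.measurableEmbedding

variable [FiniteDimensional ℝ E]

theorem measurePreserving : MeasurePreserving S.equiv :=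
  (((WithLp.linearEquiv 2 ℝ (F × L)).trans S.equiv).isometryOfInner fun p q =>
    S.inner_map p.ofLp q.ofLp).measurePreserving.comp (WithLp.volume_preserving_toLp F L)

theorem kern_map (p q : F × L) :
    kern (S.equiv p) (S.equiv q) = kern p.1 q.1 * kern p.2 q.2 := by
  simp only [kern, kexp_apply, Complex.ofReal_exp, ← Complex.exp_add, S.norm_sq_map,
    S.symp_map, S.inner_map]
  congr 1
  push_cast
  ring

theorem gaussMass_eq_mul (S : KahlerSplitting F L E) : gaussMass E = gaussMass F * gaussMass L := by
  simp only [gaussMass, ← integral_prod_mul, ← S.measurePreserving.integral_comp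
    S.measurableEmbedding fun v => Real.exp (-‖v‖ ^ 2), S.norm_sq_map, neg_add, Real.exp_add]
  rfl

theorem kernInt_map {u : E → ℂ} (hu : MemLp u 2 (volume : Measure E))
    (hslice : ∀ x, (fun l => u (S.equiv (x, l))) ∈ bargmann L) (x : F) (l : L) :
    kernInt u (S.equiv (x, l)) = gaussMass L * (Real.exp (‖l‖ ^ 2 / 2) : ℝ) *
      kernInt (fun x' => u (S.equiv (x', l))) x := by
  have hint : Integrable fun v => u v * kern (S.equiv (x, l)) v :=
    hu.integrable_mul (memLp_kern _)
  have hfiber (x' : F) : ∫ l', u (S.equiv (x', l')) * kern l l'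
      = gaussMass L * (Real.exp (‖l‖ ^ 2 / 2) : ℝ) * u (S.equiv (x', l)) :=
    kernInt_of_mem (hslice x') l
  calc kernInt u (S.equiv (x, l))
      = ∫ p : F × L, u (S.equiv p) * kern (S.equiv (x, l)) (S.equiv p) :=
        (S.measurePreserving.integral_comp S.measurableEmbedding _).symm
    _ = ∫ x', ∫ l', u (S.equiv (x', l')) * kern (S.equiv (x, l)) (S.equiv (x', l')) :=
        integral_prod _ (S.measurePreserving.integrable_comp_of_integrable hint)
    _ = ∫ x', kern x x' * ∫ l', u (S.equiv (x', l')) * kern l l' := by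
        simp only [S.kern_map, mul_left_comm (u _) (kern x _), integral_const_mul]
    _ = gaussMass L * (Real.exp (‖l‖ ^ 2 / 2) : ℝ) * kernInt (fun x' => u (S.equiv (x', l))) x := by
        simp only [hfiber, kernInt, mul_left_comm (kern x _), integral_const_mul,
          mul_comm (kern x _)]

theorem kernProj_map {u : E → ℂ} (hu : MemLp u 2 (volume : Measure E))
    (hslice : ∀ x, (fun l => u (S.equiv (x, l))) ∈ bargmann L) (x : F) (l : L) :
    kernProj u (S.equiv (x, l)) = kernProj (fun x' => u (S.equiv (x', l))) x := by
  have hmass : (gaussMass L : ℂ) ≠ 0 := Complex.ofReal_ne_zero.2 gaussMass_pos.ne'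
  have hexp : ((Real.exp (-‖S.equiv (x, l)‖ ^ 2 / 2) : ℝ) : ℂ) * (Real.exp (‖l‖ ^ 2 / 2) : ℝ)
      = (Real.exp (-‖x‖ ^ 2 / 2) : ℝ) := by
    rw [← Complex.ofReal_mul, ← Real.exp_add, S.norm_sq_map]
    ring_nf
  rw [kernProj, kernProj, S.kernInt_map hu hslice, ← hexp, S.gaussMass_eq_mul, Complex.ofReal_mul]
  field_simp

end KahlerSplitting

namespace KahlerSplitting

section FiberIntegral

variable {F L E : Type*} [NormedAddCommGroup F] [InnerProductSpace ℝ F] [KahlerSpace F]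
variable [NormedAddCommGroup L] [InnerProductSpace ℝ L] [KahlerSpace L]
variable [NormedAddCommGroup E] [InnerProductSpace ℝ E] [KahlerSpace E]
variable (S : KahlerSplitting F L E)
variable {K : Type*} [NormedAddCommGroup K] [InnerProductSpace ℝ K] (j : K →ₗᵢ[ℝ] L) {ψ : E → ℂ}

theorem exists_pow_mul_pow_mul_fiber_le (hψ : RapidDecay ψ) (k r : ℕ) :
    ∃ c : ℝ, ∀ x y, (1 + ‖x‖) ^ k * ‖ψ (S.equiv (x, j y))‖ ≤ c * ((1 + ‖y‖) ^ r)⁻¹ := by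
  obtain ⟨c, hc⟩ := hψ (k + r)
  refine ⟨c, fun x y => ?_⟩
  rw [← div_eq_mul_inv, le_div_iff₀ (by positivity)]
  calc (1 + ‖x‖) ^ k * ‖ψ (S.equiv (x, j y))‖ * (1 + ‖y‖) ^ r
      ≤ (1 + ‖S.equiv (x, j y)‖) ^ k * ‖ψ (S.equiv (x, j y))‖
        * (1 + ‖S.equiv (x, j y)‖) ^ r := by
        gcongr
        · exact S.norm_fst_le (x, j y)
        · exact (j.norm_map y).symm.trans_le (S.norm_snd_le (x, j y))
    _ = (1 + ‖S.equiv (x, j y)‖) ^ (k + r) * ‖ψ (S.equiv (x, j y))‖ := by rw [pow_add]; ring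
    _ ≤ c := hc _

theorem continuous_fiber [FiniteDimensional ℝ F] [FiniteDimensional ℝ L] (hψ : Continuous ψ) :
    Continuous fun p : F × K => ψ (S.equiv (p.1, j p.2)) := by
  have hequiv : Continuous S.equiv := LinearMap.continuous_of_finiteDimensional S.equiv.toLinearMap
  have hj := j.continuous
  fun_prop

variable [FiniteDimensional ℝ K] [MeasurableSpace K] [BorelSpace K]

/-- Integration of a function on `E` over the translates of the subspace `K` of the second
summand, as a function on the first summand. -/
def fiberInt (u : E → ℂ) (x : F) : ℂ := ∫ y : K, u (S.equiv (x, j y))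

theorem rapidDecay_fiberInt (hψ : RapidDecay ψ) : RapidDecay (S.fiberInt j ψ) := by
  intro k
  obtain ⟨r, hr⟩ := exists_integrable_inv_one_add_norm_pow (volume : Measure K)
  obtain ⟨c, hc⟩ := S.exists_pow_mul_pow_mul_fiber_le j hψ k r
  refine ⟨∫ y : K, c * ((1 + ‖y‖) ^ r)⁻¹, fun x => ?_⟩
  calc (1 + ‖x‖) ^ k * ‖S.fiberInt j ψ x‖
      ≤ (1 + ‖x‖) ^ k * ∫ y, ‖ψ (S.equiv (x, j y))‖ := by
        gcongr
        exact norm_integral_le_integral_norm _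
    _ = ∫ y, (1 + ‖x‖) ^ k * ‖ψ (S.equiv (x, j y))‖ := (integral_const_mul _ _).symm
    _ ≤ ∫ y, c * ((1 + ‖y‖) ^ r)⁻¹ :=
        integral_mono_of_nonneg (.of_forall fun y => by positivity) (hr.const_mul c)
          (.of_forall fun y => hc x y)

variable [FiniteDimensional ℝ F] [MeasurableSpace F] [BorelSpace F] [FiniteDimensional ℝ L]

theorem aestronglyMeasurable_fiberInt (hψ : Continuous ψ) :
    AEStronglyMeasurable (S.fiberInt j ψ) volume :=
  (S.continuous_fiber j hψ).stronglyMeasurable.integral_prod_right'.aestronglyMeasurable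

theorem integrable_fiber_mul_kern (hcont : Continuous ψ) (hdecay : RapidDecay ψ) (x : F) :
    Integrable (fun p : F × K => ψ (S.equiv (p.1, j p.2)) * kern x p.1) := by
  obtain ⟨r, hr⟩ := exists_integrable_inv_one_add_norm_pow (volume : Measure K)
  obtain ⟨c, hc⟩ := S.exists_pow_mul_pow_mul_fiber_le j hdecay 0 r
  have hkern : Integrable (kern x) :=
    ((integrable_gauss (by norm_num)).const_mul _).mono' (continuous_kern x).aestronglyMeasurable
      (.of_forall (norm_kern_le x))
  refine ((hr.const_mul c).mul_prod hkern.norm |>.swap).mono'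
    ((S.continuous_fiber j hcont).mul ((continuous_kern x).comp
      continuous_fst)).aestronglyMeasurable (.of_forall fun p => ?_)
  rw [norm_mul]
  refine mul_le_mul_of_nonneg_right ?_ (norm_nonneg _)
  simpa using hc p.1 p.2

theorem integral_kernProj_fiber (hcont : Continuous ψ) (hdecay : RapidDecay ψ) (x : F) :
    ∫ y, kernProj (fun x' => ψ (S.equiv (x', j y))) x = kernProj (S.fiberInt j ψ) x := by
  have hswap : ∫ y, kernInt (fun x' => ψ (S.equiv (x', j y))) x = kernInt (S.fiberInt j ψ) x := by
    simp only [kernInt, fiberInt]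
    rw [← integral_integral_swap (S.integrable_fiber_mul_kern j hcont hdecay x)]
    simp only [integral_mul_const]
  simp only [kernProj, integral_mul_const, integral_const_mul, hswap]

variable [FiniteDimensional ℝ E] [MeasurableSpace E] [BorelSpace E]

theorem fiberInt_mem_smoothVectors (hψ : ψ ∈ smoothVectors E) :
    S.fiberInt j ψ ∈ smoothVectors F := by
  obtain ⟨hψB, hdecay⟩ := mem_smoothVectors_iff.1 hψ
  have hcont := continuous_of_mem_bargmann hψB
  have hfiber := S.rapidDecay_fiberInt j hdecay
  have hreproduced : kernProj (S.fiberInt j ψ) = S.fiberInt j ψ := by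
    funext x
    rw [← S.integral_kernProj_fiber j hcont hdecay]
    simp only [kernProj_of_mem (S.slice_fst_mem_bargmann hψ _), fiberInt]
  refine mem_smoothVectors_iff.2 ⟨?_, hfiber⟩
  rw [← hreproduced]
  exact kernProj_mem_bargmann (hfiber.memLp_two (S.aestronglyMeasurable_fiberInt j hcont))

end FiberIntegral

end KahlerSplitting

/-! ### The metaplectic factor -/

/-- The endomorphism `(I - iJ) + T(I + iJ)` of the complexification, whose determinant enters the
metaplectic factor. -/
def metaplecticEnd {V : Type*} [NormedAddCommGroup V] [InnerProductSpace ℝ V] [KahlerSpace V]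
    (T : V →ₗ[ℝ] V) : Module.End ℂ (ℂ ⊗[ℝ] V) :=
  (1 - Complex.I • LinearMap.baseChange ℂ J)
    + LinearMap.baseChange ℂ T * (1 + Complex.I • LinearMap.baseChange ℂ J)

theorem metaplecticFactor_eq {V : Type*} [NormedAddCommGroup V] [InnerProductSpace ℝ V]
    [KahlerSpace V] [FiniteDimensional ℝ V] [MeasurableSpace V] [BorelSpace V] (Φ : Sp V) :
    metaplecticFactor Φ = ((2 : ℂ) ^ (Module.finrank ℝ V / 2))⁻¹ *
      LinearMap.det (metaplecticEnd ((Φ : V ≃ₗ[ℝ] V) : V →ₗ[ℝ] V)) ^ (1 / 2 : ℂ) := rfl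

theorem metaplecticEnd_id {V : Type*} [NormedAddCommGroup V] [InnerProductSpace ℝ V]
    [KahlerSpace V] : metaplecticEnd (LinearMap.id : V →ₗ[ℝ] V) = (2 : ℂ) • 1 := by
  rw [metaplecticEnd, LinearMap.baseChange_id, ← Module.End.one_eq_id, one_mul,
    sub_add_add_cancel, one_add_one_eq_two, ofNat_smul_eq_nsmul, nsmul_one, Nat.cast_ofNat]

theorem even_finrank (V : Type*) [NormedAddCommGroup V] [InnerProductSpace ℝ V] [KahlerSpace V] :
    Even (Module.finrank ℝ V) := by
  by_contra hodd
  rw [Nat.not_even_iff_odd] at hodd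
  have hsq : (J : V →ₗ[ℝ] V) ∘ₗ J = (-1 : ℝ) • LinearMap.id := by
    ext v
    simp [J_J]
  have hdet := congrArg LinearMap.det hsq
  rw [LinearMap.det_comp, LinearMap.det_smul, LinearMap.det_id, hodd.neg_one_pow] at hdet
  nlinarith [mul_self_nonneg (LinearMap.det (J : V →ₗ[ℝ] V))]

theorem mul_ofReal_cpow {r : ℝ} (hr : 0 ≤ r) (z s : ℂ) :
    (z * r) ^ s = z ^ s * (r : ℂ) ^ s := by
  obtain rfl | hs := eq_or_ne s 0
  · simp only [Complex.cpow_zero, mul_one]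
  obtain rfl | hz := eq_or_ne z 0
  · simp only [zero_mul, Complex.zero_cpow hs]
  obtain rfl | hr := hr.eq_or_lt
  · simp only [Complex.ofReal_zero, mul_zero, Complex.zero_cpow hs]
  have hr' : (r : ℂ) ≠ 0 := Complex.ofReal_ne_zero.2 hr.ne'
  rw [Complex.cpow_def_of_ne_zero (mul_ne_zero hz hr'), Complex.cpow_def_of_ne_zero hz,
    Complex.cpow_def_of_ne_zero hr', Complex.log_mul_ofReal r hr z hz, Complex.ofReal_log hr.le,
    ← Complex.exp_add, add_mul, add_comm]

namespace KahlerSplitting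

section Factor

variable {F L E : Type*} [NormedAddCommGroup F] [InnerProductSpace ℝ F] [KahlerSpace F]
variable [NormedAddCommGroup L] [InnerProductSpace ℝ L] [KahlerSpace L]
variable [NormedAddCommGroup E] [InnerProductSpace ℝ E] [KahlerSpace E]
variable (S : KahlerSplitting F L E)

/-- The decomposition of `E ⊗ ℂ` as the product of `F ⊗ ℂ` and `L ⊗ ℂ`. -/
def complexEquiv : ((ℂ ⊗[ℝ] F) × (ℂ ⊗[ℝ] L)) ≃ₗ[ℂ] ℂ ⊗[ℝ] E :=
  (TensorProduct.prodRight ℝ ℂ ℂ F L).symm ≪≫ₗ S.equiv.baseChange ℝ ℂ (F × L) E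

/-- The block diagonal endomorphisms of the complexification of `E`. -/
def blockDiag : Module.End ℂ (ℂ ⊗[ℝ] F) × Module.End ℂ (ℂ ⊗[ℝ] L) →ₐ[ℂ]
    Module.End ℂ (ℂ ⊗[ℝ] E) :=
  (S.complexEquiv.conjAlgEquiv ℂ).toAlgHom.comp (LinearMap.prodMapAlgHom ℂ _ _)

theorem baseChange_eq_blockDiag {T : E →ₗ[ℝ] E} {A : F →ₗ[ℝ] F} {B : L →ₗ[ℝ] L}
    (hT : ∀ p, T (S.equiv p) = S.equiv (A p.1, B p.2)) :
    LinearMap.baseChange ℂ T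
      = S.blockDiag (LinearMap.baseChange ℂ A, LinearMap.baseChange ℂ B) := by
  have hconj : T = S.equiv.toLinearMap ∘ₗ A.prodMap B ∘ₗ S.equiv.symm.toLinearMap := by
    ext v
    obtain ⟨p, rfl⟩ := S.equiv.surjective v
    simp [hT]
  subst hconj
  refine TensorProduct.AlgebraTensorModule.ext fun z v => ?_
  obtain ⟨⟨x, l⟩, rfl⟩ := S.equiv.surjective v
  simp [blockDiag, complexEquiv]

theorem metaplecticEnd_eq_blockDiag {T : E →ₗ[ℝ] E} {A : F →ₗ[ℝ] F} {B : L →ₗ[ℝ] L}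
    (hT : ∀ p, T (S.equiv p) = S.equiv (A p.1, B p.2)) :
    metaplecticEnd T = S.blockDiag (metaplecticEnd A, metaplecticEnd B) := by
  rw [metaplecticEnd, S.baseChange_eq_blockDiag hT, S.baseChange_eq_blockDiag S.J_map]
  simp only [← map_one S.blockDiag, ← map_smul, ← map_add, ← map_sub, ← map_mul]
  rfl

variable [FiniteDimensional ℝ F] [FiniteDimensional ℝ L]

theorem det_blockDiag (A : Module.End ℂ (ℂ ⊗[ℝ] F)) (B : Module.End ℂ (ℂ ⊗[ℝ] L)) :
    LinearMap.det (S.blockDiag (A, B)) = LinearMap.det A * LinearMap.det B :=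
  (LinearMap.det_conj _ S.complexEquiv).trans (LinearMap.det_prodMap A B)

variable [MeasurableSpace F] [BorelSpace F]
variable [FiniteDimensional ℝ E] [MeasurableSpace E] [BorelSpace E]

theorem metaplecticFactor_eq_of_fst {Φ : Sp E} {φ : Sp F}
    (hΦ : ∀ p, (Φ : E ≃ₗ[ℝ] E) (S.equiv p) = S.equiv ((φ : F ≃ₗ[ℝ] F) p.1, p.2)) :
    metaplecticFactor Φ = metaplecticFactor φ := by
  obtain ⟨m, hm⟩ := even_finrank L
  obtain ⟨n, hn⟩ := even_finrank F
  have hE : Module.finrank ℝ E / 2 = n + m := by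
    rw [← S.equiv.finrank_eq, Module.finrank_prod]
    omega
  have hdet : LinearMap.det (metaplecticEnd ((Φ : E ≃ₗ[ℝ] E) : E →ₗ[ℝ] E))
      = LinearMap.det (metaplecticEnd ((φ : F ≃ₗ[ℝ] F) : F →ₗ[ℝ] F))
        * ((2 ^ m) ^ 2 : ℝ) := by
    rw [S.metaplecticEnd_eq_blockDiag (A := ((φ : F ≃ₗ[ℝ] F) : F →ₗ[ℝ] F)) (B := LinearMap.id) hΦ,
      det_blockDiag, metaplecticEnd_id, LinearMap.det_smul, map_one, mul_one,
      Module.finrank_baseChange, hm]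
    push_cast
    ring
  have hsqrt : (((2 ^ m) ^ 2 : ℝ) : ℂ) ^ (1 / 2 : ℂ) = 2 ^ m := by
    rw [Complex.ofReal_pow, one_div, Complex.sq_cpow_two_inv (by norm_cast; positivity)]
    norm_cast
  rw [metaplecticFactor_eq, metaplecticFactor_eq, hE, hdet, mul_ofReal_cpow (by positivity), hsqrt,
    hn, ← two_mul n, Nat.mul_div_cancel_left _ two_pos, pow_add]
  field_simp

end Factor

variable {F L E : Type*} [NormedAddCommGroup F] [InnerProductSpace ℝ F] [KahlerSpace F]
variable [FiniteDimensional ℝ F] [MeasurableSpace F] [BorelSpace F]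
variable [NormedAddCommGroup L] [InnerProductSpace ℝ L] [KahlerSpace L]
variable [FiniteDimensional ℝ L] [MeasurableSpace L] [BorelSpace L]
variable [NormedAddCommGroup E] [InnerProductSpace ℝ E] [KahlerSpace E]
variable [FiniteDimensional ℝ E] [MeasurableSpace E] [BorelSpace E]
variable (S : KahlerSplitting F L E)
variable {K : Type*} [NormedAddCommGroup K] [InnerProductSpace ℝ K] [FiniteDimensional ℝ K]
variable [MeasurableSpace K] [BorelSpace K] (j : K →ₗᵢ[ℝ] L)

theorem fiberInt_kernProj {u : E → ℂ} (hcont : Continuous u) (hdecay : RapidDecay u)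
    (hslice : ∀ x, (fun l => u (S.equiv (x, l))) ∈ bargmann L) :
    S.fiberInt j (kernProj u) = kernProj (S.fiberInt j u) := by
  funext x
  rw [← S.integral_kernProj_fiber j hcont hdecay]
  simp only [fiberInt, S.kernProj_map (hdecay.memLp_two hcont.aestronglyMeasurable) hslice]

theorem fiberInt_metaplectic {Φ : Sp E} {φ : Sp F}
    (hΦ : ∀ p, (Φ : E ≃ₗ[ℝ] E) (S.equiv p) = S.equiv ((φ : F ≃ₗ[ℝ] F) p.1, p.2))
    {ψ : bargmann E} (hψ : (ψ : E → ℂ) ∈ smoothVectors E) (hmem : S.fiberInt j ψ ∈ bargmann F) :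
    S.fiberInt j (metaplectic Φ ψ : E → ℂ) = metaplectic φ ⟨S.fiberInt j ψ, hmem⟩ := by
  let u : E → ℂ := fun v => (ψ : E → ℂ) ((Φ : E ≃ₗ[ℝ] E).symm v)
  have hsymm (x : F) (l : L) :
      (Φ : E ≃ₗ[ℝ] E).symm (S.equiv (x, l)) = S.equiv ((φ : F ≃ₗ[ℝ] F).symm x, l) := by
    rw [LinearEquiv.symm_apply_eq, hΦ, LinearEquiv.apply_symm_apply]
  have hcont : Continuous u := (continuous_of_mem_bargmann ψ.2).comp
    (LinearMap.continuous_of_finiteDimensional ((Φ : E ≃ₗ[ℝ] E).symm : E →ₗ[ℝ] E))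
  have hdecay : RapidDecay u := (mem_smoothVectors_iff.1 hψ).2.comp_linearEquiv _
  have hslice (x : F) : (fun l => u (S.equiv (x, l))) ∈ bargmann L := by
    simp only [u, hsymm]
    exact S.slice_snd_mem_bargmann hψ _
  have hfiber : S.fiberInt j u = fun x => S.fiberInt j ψ ((φ : F ≃ₗ[ℝ] F).symm x) := by
    funext x
    simp only [fiberInt, u, hsymm]
  calc S.fiberInt j (metaplectic Φ ψ : E → ℂ)
      = S.fiberInt j (metaplecticFactor φ • kernProj u) := by
        rw [metaplectic_apply, S.metaplecticFactor_eq_of_fst hΦ]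
    _ = metaplecticFactor φ • S.fiberInt j (kernProj u) := funext fun x => integral_const_mul _ _
    _ = metaplectic φ ⟨S.fiberInt j ψ, hmem⟩ := by
        rw [S.fiberInt_kernProj j hcont hdecay hslice, hfiber, metaplectic_apply]

end KahlerSplitting

/-! ### The splitting defined by a coisotropic subspace -/

section Reduction

variable {E : Type*} [NormedAddCommGroup E] [InnerProductSpace ℝ E] [FiniteDimensional ℝ E]
variable [KahlerSpace E] (C : Submodule ℝ E)

theorem map_J_maxComplex : (maxComplex C).map J = maxComplex C := by
  refine le_antisymm ?_ fun v hv => ⟨-J v, (maxComplex C).neg_mem (J_mem_maxComplex hv), ?_⟩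
  · rintro _ ⟨v, hv, rfl⟩
    exact J_mem_maxComplex hv
  · rw [map_neg, J_J, neg_neg]

theorem sympAnn_maxComplex : sympAnn (maxComplex C) = (maxComplex C)ᗮ := by
  rw [sympAnn_eq, map_J_maxComplex]

variable {C}

theorem J_mem_sympAnn_maxComplex {v : E} (hv : v ∈ sympAnn (maxComplex C)) :
    J v ∈ sympAnn (maxComplex C) := by
  rw [mem_sympAnn] at hv ⊢
  intro u hu
  rw [← symp_J_J, J_J, map_neg, hv _ (J_mem_maxComplex hu), neg_zero]

theorem map_mem_maxComplex {Φ : Sp E}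
    (hΦ : ∀ v ∈ sympAnn (maxComplex C), (Φ : E ≃ₗ[ℝ] E) v = v) {v : E} (hv : v ∈ maxComplex C) :
    (Φ : E ≃ₗ[ℝ] E) v ∈ maxComplex C := by
  rw [← Submodule.orthogonal_orthogonal (maxComplex C), ← sympAnn_maxComplex,
    Submodule.mem_orthogonal]
  intro l hl
  have hJl := J_mem_sympAnn_maxComplex hl
  rw [real_inner_comm, inner_eq, ← hΦ _ hJl, Φ.2]
  exact mem_sympAnn.1 hJl v hv

/-- The Kähler structure which `H°`, being the orthogonal complement of the complex subspace `H`,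
inherits from `E`. -/
instance instKahlerSpaceSympAnn : KahlerSpace (sympAnn (maxComplex C)) where
  J := (J : E →ₗ[ℝ] E).restrict fun _ hv => J_mem_sympAnn_maxComplex hv
  symp := (symp : LinearMap.BilinForm ℝ E).compl₁₂ (sympAnn (maxComplex C)).subtype
    (sympAnn (maxComplex C)).subtype
  J_J v := Subtype.ext (J_J (v : E))
  symp_self v := symp_self (v : E)
  inner_eq u v := inner_eq (u : E) v

variable (C)

/-- The inclusion of `C°` into `H°`. -/
def annInclusion : sympAnn C →ₗᵢ[ℝ] sympAnn (maxComplex C) where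
  toLinearMap := Submodule.inclusion fun _ hv u hu => hv u hu.1
  norm_map' _ := rfl

variable [IsCoisotropic C]

theorem horizontal_symm_J (x : Reduction C) :
    ((horizontal C).symm (J x) : E) = J ((horizontal C).symm x : E) := by
  change (((horizontal C).symm (horizontal C _) : maxComplex C) : E) = _
  rw [LinearEquiv.symm_apply_apply]
  rfl

/-- The splitting of `E` into the reduction `F ≅ H` and the orthogonal complement `H°` of `H`. -/
def reductionSplitting : KahlerSplitting (Reduction C) (sympAnn (maxComplex C)) E where
  equiv := ((horizontal C).symm.prodCongr (LinearEquiv.refl ℝ _)) ≪≫ₗ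
    Submodule.prodEquivOfIsCompl _ _ (sympAnn_maxComplex C ▸ Submodule.isCompl_orthogonal _)
  inner_map p q := by
    have horth (x : Reduction C) (l : sympAnn (maxComplex C)) :
        inner ℝ ((horizontal C).symm x : E) (l : E) = 0 :=
      Submodule.inner_right_of_mem_orthogonal ((horizontal C).symm x).2
        (sympAnn_maxComplex C ▸ l.2)
    have hinner : inner ℝ p.1 q.1
        = inner ℝ ((horizontal C).symm p.1 : E) ((horizontal C).symm q.1 : E) := rfl
    simp [inner_add_left, inner_add_right, horth, hinner, real_inner_comm _ (p.2 : E)]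
  J_map p := by
    have hJ : ((J p.2 : sympAnn (maxComplex C)) : E) = J (p.2 : E) := rfl
    simp [horizontal_symm_J, hJ]

theorem reductionSplitting_apply (x : Reduction C) (l : sympAnn (maxComplex C)) :
    (reductionSplitting C).equiv (x, l) = ((horizontal C).symm x : E) + l := by
  simp [reductionSplitting]

variable {C}

theorem map_reductionSplitting {Φ : Sp E} (hC : C.map ((Φ : E ≃ₗ[ℝ] E) : E →ₗ[ℝ] E) = C)
    (hΦ : ∀ v ∈ sympAnn (maxComplex C), (Φ : E ≃ₗ[ℝ] E) v = v)
    (p : Reduction C × sympAnn (maxComplex C)) :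
    (Φ : E ≃ₗ[ℝ] E) ((reductionSplitting C).equiv p) = (reductionSplitting C).equiv
      ((reducedMap Φ hC : Reduction C ≃ₗ[ℝ] Reduction C) p.1, p.2) := by
  obtain ⟨x, l⟩ := p
  obtain ⟨h, rfl⟩ := (horizontal C).surjective x
  have hreduced : (reducedMap Φ hC : Reduction C ≃ₗ[ℝ] Reduction C) (horizontal C h)
      = horizontal C ⟨(Φ : E ≃ₗ[ℝ] E) h, map_mem_maxComplex hΦ h.2⟩ := by
    rw [horizontal_apply, reducedMap_proj, horizontal_apply]
  simp only [reductionSplitting_apply, map_add, hΦ _ l.2, hreduced, LinearEquiv.symm_apply_apply]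

variable [MeasurableSpace E] [BorelSpace E]

theorem reduce_eq_fiberInt (ψ : E → ℂ) :
    reduce C ψ = (reductionSplitting C).fiberInt (annInclusion C) ψ := by
  funext x
  obtain ⟨h, rfl⟩ := (horizontal C).surjective x
  rw [horizontal_apply, reduce_proj, ← horizontal_apply]
  simp only [KahlerSplitting.fiberInt, reductionSplitting_apply, LinearEquiv.symm_apply_apply]
  rfl

theorem integrable_add_of_mem_smoothVectors {ψ : E → ℂ} (hψ : ψ ∈ smoothVectors E)
    (S : Submodule ℝ E) (v : E) : Integrable fun y : S => ψ (v + (y : E)) := by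
  have hcont := continuous_of_mem_bargmann hψ.1
  have hdecay : RapidDecay fun y : S => ψ (v + (y : E)) :=
    (mem_smoothVectors_iff.1 hψ).2.comp_antilipschitz
      ((isometry_add_left v).comp S.subtypeₗᵢ.isometry).antilipschitz
  exact hdecay.integrable (by fun_prop : Continuous _).aestronglyMeasurable

end Reduction

end BargmannReduction

end

theorem proposition4p5 {E : Type*} [NormedAddCommGroup E] [InnerProductSpace ℝ E]
    [FiniteDimensional ℝ E] [MeasurableSpace E] [BorelSpace E] [KahlerSpace E]
    (C : Submodule ℝ E) [IsCoisotropic C] (Φ : Sp E)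
    (hC : C.map ((Φ : E ≃ₗ[ℝ] E) : E →ₗ[ℝ] E) = C)
    (hH : ∀ v ∈ sympAnn (maxComplex C), (Φ : E ≃ₗ[ℝ] E) v = v) :
    -- `R` is a well-defined operator from `B^∞(E)` to `B^∞(F)`
    (∀ ψ ∈ smoothVectors E,
      (∀ v : C, Integrable (fun y : sympAnn C => ψ ((v : E) + (y : E))) volume) ∧
        reduce C ψ ∈ smoothVectors (Reduction C)) ∧
    -- `W(Φ)` preserves `B^∞(E)`, and `R ∘ W(Φ) = W(φ) ∘ R` there
    (∀ ψ : bargmann E, (ψ : E → ℂ) ∈ smoothVectors E →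
      (metaplectic Φ ψ : E → ℂ) ∈ smoothVectors E ∧
      ∃ h : reduce C ψ ∈ bargmann (Reduction C),
        reduce C (metaplectic Φ ψ) = metaplectic (reducedMap Φ hC) ⟨reduce C ψ, h⟩) := by
  have hR : ∀ ψ ∈ smoothVectors E, reduce C ψ ∈ smoothVectors (Reduction C) := fun ψ hψ => by
    rw [reduce_eq_fiberInt]
    exact (reductionSplitting C).fiberInt_mem_smoothVectors _ hψ
  refine ⟨fun ψ hψ => ⟨fun v => integrable_add_of_mem_smoothVectors hψ _ v, hR ψ hψ⟩, fun ψ hψ =>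
    ⟨metaplectic_mem_smoothVectors Φ hψ, (hR ψ hψ).1, ?_⟩⟩
  simp only [reduce_eq_fiberInt]
  exact (reductionSplitting C).fiberInt_metaplectic _ (map_reductionSplitting hC hH) hψ _
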